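/- There is an absolute constant $\sigma>0$ such that the following holds. Let $K\subset\mathbb{R}$ be a compact interval and let $\chi:\mathbb{R}\to\mathbb{R}$ be smooth and compactly supported with $0\le\chi\le 1$. Then there is a constant $C$, depending only on $K$ and $\chi$, such that for all $f_0\in L^\infty(\mathbb{R})$ supported in $K$ and all $f_1,f_2\in L^2(\mathbb{R})$ (complex-valued), the function $(x,t)\mapsto f_0(x)f_1(x+t)f_2(x+t^2)\chi(t)$ is integrable on $\mathbb{R}^2$ and $$\Big|\iint f_0(x)\,f_1(x+t)\,f_2(x+t^2)\,\chi(t)\,dt\,dx\Big|\le C\,\|f_0\|_{L^\infty}\|f_1\|_{L^2}\|f_2\|_{H^{-\sigma}}.$$ Here $\|f\|_{H^{-\sigma}}^2=\int_{\mathbb{R}}|\widehat f(\xi)|^2(1+|\xi|^2)^{-\sigma}\,d\xi$, where $\widehat f$ is the ($L^2$-)Fourier transform, given by $\widehat f(\xi)=\int f(x)e^{-2\pi i x\xi}\,dx$ for $f \in L^1\cap L^2$. -/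

import Mathlib

open MeasureTheory
open scoped FourierTransform ENNReal NNReal

/-- The integrand `(x, t) ↦ f₀(x) f₁(x + t) f₂(x + t²) χ(t)` of the trilinear form. -/
def trilinearIntegrand (χ : ℝ → ℝ) (f₀ f₁ f₂ : ℝ → ℂ) (x t : ℝ) : ℂ :=
  f₀ x * f₁ (x + t) * f₂ (x + t ^ 2) * (χ t : ℂ)

/-- The trilinear form `|∬ f₀(x) f₁(x + t) f₂(x + t²) χ(t) dt dx|`. -/
noncomputable def trilinearForm (χ : ℝ → ℝ) (f₀ f₁ f₂ : ℝ → ℂ) : ℝ :=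
  ‖∫ x : ℝ, ∫ t : ℝ, trilinearIntegrand χ f₀ f₁ f₂ x t‖

/-- The norm `‖f‖_{H^s} = (∫ |f̂(ξ)|² (1 + |ξ|²)^s dξ)^{1/2}` of a function `f ∈ L²(ℝ)`, where
`f̂` is the `L²` Fourier transform of `f`, normalised with the phase `e^{-2πixξ}`. The integral is
the `[0, ∞]`-valued one (it is finite for `s ≤ 0`). -/
noncomputable def sobolevNorm (s : ℝ) (f : Lp ℂ 2 (volume : Measure ℝ)) : ℝ≥0∞ :=
  (∫⁻ ξ : ℝ, ENNReal.ofReal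
    (‖(𝓕 f : Lp ℂ 2 (volume : Measure ℝ)) ξ‖ ^ 2 * (1 + |ξ| ^ 2) ^ s)) ^ (1 / 2 : ℝ)

/-! Fix `f₀`, `f₁` and view the form as a linear functional of `f₂`. By the Riesz theorem it is the
pairing with some `G ∈ L²`, and the claim says that `G` lies in `H^σ` with the right norm. This is a
smoothing statement. It suffices that `G` is Hölder continuous in `L²` under translations, `‖G(· -
h) - G‖₂ ≲ h^(1/128)` for `0 < h ≤ 1`: by Plancherel this controls `∫ |e^(-2πihξ) - 1|² |Ĝ(ξ)|² dξ`,
and a weighted sum over dyadic `h` recovers the Sobolev weight (`lintegral_sobolev_weight_le`). By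
duality, one has to bound the form by `h^(1/128)` when `f₂ = F(· + h) - F`
(`exists_translation_bound`).

With `y = x + t` the form is bilinear in `f₀`, `f₁` with kernel `f₂(x + (y - x)²) χ(y - x)`. Two
applications of Cauchy-Schwarz remove `f₀` and `f₁` and leave a box form: an integral over a base
point `v` and three parameters `z = (k, t, l)` of a product of four copies of `f = f₂`, at `v`, `v +
A(z)`, `v + B(z)`, `v + C(z)`, with `A`, `B`, `C` quadratic polynomials (`box_cauchy_schwarz`,
`box_integral_eq`). The map `(A, B, C)` is generically a local diffeomorphism. So there is a vector
field in `z` that leaves `A` and `B` fixed but moves `C`, and integration by parts along it replaces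
the last `f` by its primitive `g` (`integral_parts`). For `f = F(· + h) - F` the primitive is an
integral of `F` over an interval of length `h`, so `‖g‖₂ ≤ h ‖F‖₂`: this is the gain.

Integration by parts requires division by the Jacobian, which vanishes on three planes. A
regularised inverse is used instead. Its error is concentrated near these planes, where the box form
is small in absolute value: pairing the factors first with fourth and second with third,
Cauchy-Schwarz bounds the absolute form by `L²` norms times a two-dimensional integral of the weight
(`lintegral_box_le`), and near the planes that integral is `O(√ρ)`. Balancing the width `ρ` against
`h` gives a power of `h`. -/

/-! ### Cauchy-Schwarz for bilinear forms with a kernel. -/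

section BoxCauchySchwarz

open ComplexConjugate

/-- The Cauchy-Schwarz inequality for the integral of a product. -/
theorem norm_integral_mul_sq_le {α : Type*} [MeasurableSpace α] {μ : Measure α} {f g : α → ℂ}
    (hf : MemLp f 2 μ) (hg : MemLp g 2 μ) :
    ‖∫ x, f x * g x ∂μ‖ ^ 2 ≤ (∫ x, ‖f x‖ ^ 2 ∂μ) * ∫ x, ‖g x‖ ^ 2 ∂μ := by
  have h1 : ‖∫ x, f x * g x ∂μ‖ ≤ ∫ x, ‖f x‖ * ‖g x‖ ∂μ := by
    refine (norm_integral_le_integral_norm _).trans (le_of_eq ?_)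
    simp
  have h2 := integral_mul_le_Lp_mul_Lq_of_nonneg (μ := μ) (p := 2) (q := 2)
    Real.HolderConjugate.two_two
    (f := fun x => ‖f x‖) (g := fun x => ‖g x‖) (by filter_upwards with x using norm_nonneg _)
    (by filter_upwards with x using norm_nonneg _) (by simpa using hf.norm) (by simpa using hg.norm)
  have ha : 0 ≤ ∫ x, ‖f x‖ ^ 2 ∂μ := by positivity
  have hb : 0 ≤ ∫ x, ‖g x‖ ^ 2 ∂μ := by positivity
  have h3 : ‖∫ x, f x * g x ∂μ‖ ≤ √(∫ x, ‖f x‖ ^ 2 ∂μ) * √(∫ x, ‖g x‖ ^ 2 ∂μ) := by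
    rw [Real.sqrt_eq_rpow, Real.sqrt_eq_rpow]
    simpa using h1.trans h2
  calc _ ≤ (√(∫ x, ‖f x‖ ^ 2 ∂μ) * √(∫ x, ‖g x‖ ^ 2 ∂μ)) ^ 2 := by gcongr
    _ = _ := by rw [mul_pow, Real.sq_sqrt ha, Real.sq_sqrt hb]

/-- A function of two real variables with compact support is supported in a square. -/
theorem exists_square_of_hasCompactSupport {k : ℝ → ℝ → ℂ}
    (hks : HasCompactSupport (Function.uncurry k)) :
    ∃ S : Set ℝ, IsCompact S ∧ ∀ x y, (x ∉ S ∨ y ∉ S) → k x y = 0 := by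
  refine ⟨Prod.fst '' tsupport (Function.uncurry k) ∪ Prod.snd '' tsupport (Function.uncurry k),
    (hks.isCompact.image continuous_fst).union (hks.isCompact.image continuous_snd), ?_⟩
  intro x y h
  by_contra hxy
  have hmem : (x, y) ∈ tsupport (Function.uncurry k) := subset_tsupport _ hxy
  rcases h with h | h
  · exact h (Or.inl ⟨_, hmem, rfl⟩)
  · exact h (Or.inr ⟨_, hmem, rfl⟩)

/-- The kernel of `K* K` is continuous and compactly supported if that of `K` is. -/
theorem continuous_kernel_comp {k : ℝ → ℝ → ℂ} (hk : Continuous (Function.uncurry k))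
    (hks : HasCompactSupport (Function.uncurry k)) :
    Continuous (fun p : ℝ × ℝ => ∫ x, k x p.1 * conj (k x p.2)) ∧
      HasCompactSupport (fun p : ℝ × ℝ => ∫ x, k x p.1 * conj (k x p.2)) := by
  obtain ⟨S, hS, h0⟩ := exists_square_of_hasCompactSupport hks
  constructor
  · have : (fun p : ℝ × ℝ => ∫ x, k x p.1 * conj (k x p.2))
        = fun p : ℝ × ℝ => ∫ x in S, k x p.1 * conj (k x p.2) := by
      ext p
      rw [setIntegral_eq_integral_of_forall_compl_eq_zero]
      intro x hx
      rw [h0 x _ (Or.inl hx), zero_mul]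
    rw [this]
    apply continuous_parametric_integral_of_continuous _ hS
    have h1 : Continuous fun z : (ℝ × ℝ) × ℝ => k z.2 z.1.1 :=
      hk.comp (f := fun z : (ℝ × ℝ) × ℝ => (z.2, z.1.1)) (by fun_prop)
    have h2 : Continuous fun z : (ℝ × ℝ) × ℝ => k z.2 z.1.2 :=
      hk.comp (f := fun z : (ℝ × ℝ) × ℝ => (z.2, z.1.2)) (by fun_prop)
    exact h1.mul (Complex.continuous_conj.comp h2)
  · refine HasCompactSupport.intro (hS.prod hS) ?_
    intro p hp
    have : p.1 ∉ S ∨ p.2 ∉ S := by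
      by_contra! h
      exact hp ⟨h.1, h.2⟩
    rcases this with h | h
    · simp [h0 _ _ (Or.inr h)]
    · simp [h0 _ _ (Or.inr h)]

/-- Two applications of the Cauchy-Schwarz inequality to a bilinear form with continuous kernel. -/
theorem box_cauchy_schwarz {k : ℝ → ℝ → ℂ} (hk : Continuous (Function.uncurry k))
    (hks : HasCompactSupport (Function.uncurry k)) {f₀ f₁ : ℝ → ℂ} (h₀ : MemLp f₀ 2 volume)
    (h₁ : MemLp f₁ 2 volume) :
    ‖∫ x, f₀ x * ∫ y, f₁ y * k x y‖ ^ 4 ≤ (∫ x, ‖f₀ x‖ ^ 2) ^ 2 * (∫ x, ‖f₁ x‖ ^ 2) ^ 2 *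
      ∫ p : ℝ × ℝ, ‖∫ x, k x p.1 * conj (k x p.2)‖ ^ 2 := by
  obtain ⟨S, hS, hS0⟩ := exists_square_of_hasCompactSupport hks
  have hSm := hS.measurableSet
  have hSfin : volume S < ⊤ := hS.measure_lt_top
  obtain ⟨M, hM⟩ := hk.bounded_above_of_compact_support hks
  have hM' : ∀ x y, ‖k x y‖ ≤ M := fun x y => hM (x, y)
  -- Truncation to the compact set `S` does not change the form and makes `f₁` integrable, which
  -- Fubini's theorem needs below.
  set F : ℝ → ℂ := S.indicator f₁ with hF
  have hF2 : MemLp F 2 volume := h₁.indicator hSm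
  have hF1 : Integrable F := by
    rw [hF, integrable_indicator_iff hSm]
    have : IsFiniteMeasure (volume.restrict S) := ⟨by simpa using hSfin⟩
    exact (h₁.restrict S).integrable (by norm_num)
  have hFk : ∀ x y, f₁ y * k x y = F y * k x y := by
    intro x y
    by_cases hy : y ∈ S
    · simp [hF, hy]
    · simp [hS0 x y (Or.inr hy)]
  have hkm : ∀ x, Continuous (k x) := fun x => hk.comp (by fun_prop : Continuous fun y => (x, y))
  set A : ℝ → ℂ := fun x => ∫ y, f₁ y * k x y with hA
  -- The indicator in the first variable supplies integrability there; it is dropped in `hI'`, since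
  -- the kernel vanishes off `S`.
  have hI : Integrable (fun z : ℝ × (ℝ × ℝ) =>
      (S.indicator (fun _ => (1 : ℂ)) z.1 * (F z.2.1 * conj (F z.2.2))) *
        (k z.1 z.2.1 * conj (k z.1 z.2.2))) (volume.prod (volume.prod volume)) := by
    have hi1 : Integrable (S.indicator (fun _ => (1 : ℂ))) := by
      rw [integrable_indicator_iff hSm]
      exact integrableOn_const hSfin.ne
    have hi2 : Integrable (fun y => conj (F y)) := by
      refine hF1.mono ?_ (by simp)
      exact Complex.continuous_conj.comp_aestronglyMeasurable hF1.1
    refine (hi1.mul_prod (hF1.mul_prod hi2)).mul_bdd (c := M * M) ?_ ?_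
    · have a1 : Continuous fun z : ℝ × (ℝ × ℝ) => k z.1 z.2.1 :=
        hk.comp (f := fun z : ℝ × (ℝ × ℝ) => (z.1, z.2.1)) (by fun_prop)
      have a2 : Continuous fun z : ℝ × (ℝ × ℝ) => k z.1 z.2.2 :=
        hk.comp (f := fun z : ℝ × (ℝ × ℝ) => (z.1, z.2.2)) (by fun_prop)
      exact (a1.mul (Complex.continuous_conj.comp a2)).aestronglyMeasurable
    · filter_upwards with z
      rw [norm_mul, RCLike.norm_conj]
      exact mul_le_mul (hM' _ _) (hM' _ _) (norm_nonneg _) ((norm_nonneg _).trans (hM' 0 0))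
  have hI' : Integrable (fun z : ℝ × (ℝ × ℝ) => (F z.2.1 * conj (F z.2.2)) *
        (k z.1 z.2.1 * conj (k z.1 z.2.2))) (volume.prod (volume.prod volume)) := by
    refine hI.congr ?_
    filter_upwards with z
    by_cases hz : z.1 ∈ S
    · simp [hz]
    · simp [hS0 _ _ (Or.inl hz)]
  have hAsq : ∀ x, ((‖A x‖ ^ 2 : ℝ) : ℂ) = ∫ p : ℝ × ℝ, (F p.1 * conj (F p.2)) *
        (k x p.1 * conj (k x p.2)) := by
    intro x
    have e1 : A x = ∫ y, F y * k x y := by simp only [hA, hFk]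
    have e2 : conj (A x) = ∫ y, conj (F y * k x y) := by rw [e1, integral_conj]
    have e3 : ((‖A x‖ ^ 2 : ℝ) : ℂ) = A x * conj (A x) := by
      rw [Complex.mul_conj, Complex.normSq_eq_norm_sq]
    rw [e3, e2, e1, ← integral_prod_mul]
    refine integral_congr_ae ?_
    filter_upwards with p
    simp only [map_mul]
    ring
  have hAint : Integrable (fun x => ‖A x‖ ^ 2) := by
    have := hI'.integral_prod_left
    refine this.re.congr ?_
    filter_upwards with x
    exact (congrArg Complex.re (hAsq x).symm).trans (Complex.ofReal_re _)
  have hAm : AEStronglyMeasurable A volume := by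
    have hz : Integrable (fun z : ℝ × ℝ => (S.indicator (fun _ => (1 : ℂ)) z.1 * F z.2) * k z.1 z.2)
        (volume.prod volume) := by
      have hi1 : Integrable (S.indicator (fun _ => (1 : ℂ))) := by
        rw [integrable_indicator_iff hSm]
        exact integrableOn_const hSfin.ne
      exact (hi1.mul_prod hF1).mul_bdd (c := M) hk.aestronglyMeasurable
        (by filter_upwards with z using hM' _ _)
    refine hz.integral_prod_left.1.congr ?_
    filter_upwards with x
    refine integral_congr_ae ?_
    filter_upwards with y
    by_cases hx : x ∈ S
    · simp [hx, hFk]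
    · simp [hS0 _ _ (Or.inl hx)]
  have hA2 : MemLp A 2 volume := (memLp_two_iff_integrable_sq_norm hAm).2 hAint
  have step1 := norm_integral_mul_sq_le h₀ hA2
  obtain ⟨hBc, hBs⟩ := continuous_kernel_comp hk hks
  set B : ℝ × ℝ → ℂ := fun p => ∫ x, k x p.1 * conj (k x p.2) with hB
  -- Expanding the square and integrating in `x` first leaves the kernel `B` of `K* K` paired with
  -- `F ⊗ conj F`, ready for the second Cauchy-Schwarz.
  have e4 : ((∫ x, ‖A x‖ ^ 2 : ℝ) : ℂ) = ∫ p : ℝ × ℝ, (F p.1 * conj (F p.2)) * B p := by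
    have hswap := (integral_prod _ hI').symm.trans (integral_prod_symm _ hI')
    rw [← integral_complex_ofReal, integral_congr_ae (Filter.Eventually.of_forall hAsq)]
    refine hswap.trans (integral_congr_ae (Filter.Eventually.of_forall fun p => ?_))
    exact integral_const_mul (F p.1 * conj (F p.2)) _
  have hFF2 : Integrable (fun p : ℝ × ℝ => ‖F p.1‖ ^ 2 * ‖F p.2‖ ^ 2) :=
    hF2.norm.integrable_sq.mul_prod hF2.norm.integrable_sq
  have hFm1 : AEStronglyMeasurable (fun p : ℝ × ℝ => F p.1) (volume.prod volume) :=
    hF2.1.comp_fst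
  have hFm2 : AEStronglyMeasurable (fun p : ℝ × ℝ => F p.2) (volume.prod volume) :=
    hF2.1.comp_snd
  have hFFm : AEStronglyMeasurable (fun p : ℝ × ℝ => F p.1 * conj (F p.2)) volume :=
    hFm1.mul (Complex.continuous_conj.comp_aestronglyMeasurable hFm2)
  have hFF : MemLp (fun p : ℝ × ℝ => F p.1 * conj (F p.2)) 2 volume := by
    refine (memLp_two_iff_integrable_sq_norm hFFm).2 ?_
    refine hFF2.congr ?_
    filter_upwards with p
    simp [mul_pow]
  have step2 := norm_integral_mul_sq_le hFF (hBc.memLp_of_hasCompactSupport hBs)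
  rw [← e4] at step2
  have hnF : ∫ p : ℝ × ℝ, ‖F p.1 * conj (F p.2)‖ ^ 2 = (∫ x, ‖F x‖ ^ 2) ^ 2 := by
    rw [sq (∫ x, ‖F x‖ ^ 2), ← integral_prod_mul]
    simp [mul_pow, Measure.volume_eq_prod]
  have hFle : ∫ x, ‖F x‖ ^ 2 ≤ ∫ x, ‖f₁ x‖ ^ 2 := by
    refine integral_mono hF2.norm.integrable_sq h₁.norm.integrable_sq ?_
    intro x
    by_cases hx : x ∈ S <;> simp [hF, hx]
  have hnA : ‖((∫ x, ‖A x‖ ^ 2 : ℝ) : ℂ)‖ = ∫ x, ‖A x‖ ^ 2 := by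
    rw [Complex.norm_real, Real.norm_of_nonneg (by positivity)]
  rw [hnA, hnF] at step2
  have hQ : 0 ≤ ∫ p : ℝ × ℝ, ‖B p‖ ^ 2 := by positivity
  calc ‖∫ x, f₀ x * A x‖ ^ 4 = (‖∫ x, f₀ x * A x‖ ^ 2) ^ 2 := by ring
    _ ≤ ((∫ x, ‖f₀ x‖ ^ 2) * ∫ x, ‖A x‖ ^ 2) ^ 2 := by gcongr
    _ = (∫ x, ‖f₀ x‖ ^ 2) ^ 2 * (∫ x, ‖A x‖ ^ 2) ^ 2 := by ring
    _ ≤ (∫ x, ‖f₀ x‖ ^ 2) ^ 2 * ((∫ x, ‖F x‖ ^ 2) ^ 2 * ∫ p : ℝ × ℝ, ‖B p‖ ^ 2) := by gcongr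
    _ ≤ (∫ x, ‖f₀ x‖ ^ 2) ^ 2 * ((∫ x, ‖f₁ x‖ ^ 2) ^ 2 * ∫ p : ℝ × ℝ, ‖B p‖ ^ 2) := by gcongr
    _ = _ := by ring

end BoxCauchySchwarz

/-! ### The box form in translation variables. -/

section BoxForm

open ComplexConjugate

/-- The kernel `k(x, y) = f(x + (y - x)²) χ(y - x)` with
`∬ f₀(x) f₁(y) k(x, y) = ∬ f₀(x) f₁(x + t) f(x + t²) χ(t)`. -/
def parabolaKernel (χ : ℝ → ℝ) (f : ℝ → ℂ) (x y : ℝ) : ℂ :=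
  f (x + (y - x) ^ 2) * (χ (y - x) : ℂ)

/-- The product of the four cutoffs, in the variables `z = (k, t, l)`. -/
def boxCutoff (χ : ℝ → ℝ) (z : ℝ × ℝ × ℝ) : ℝ :=
  χ z.2.1 * χ (z.2.1 + z.1) * χ (z.2.1 + z.2.2) * χ (z.2.1 + z.1 + z.2.2)

/-- The difference of the second and the first argument in the box form. -/
def shiftA (z : ℝ × ℝ × ℝ) : ℝ := (z.2.1 + z.1) ^ 2 - z.2.1 ^ 2

/-- The difference of the third and the first argument in the box form. -/
def shiftB (z : ℝ × ℝ × ℝ) : ℝ := (z.2.1 + z.2.2) ^ 2 - z.2.2 - z.2.1 ^ 2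

/-- The difference of the fourth and the first argument in the box form. -/
def shiftC (z : ℝ × ℝ × ℝ) : ℝ := (z.2.1 + z.1 + z.2.2) ^ 2 - z.2.2 - z.2.1 ^ 2

theorem continuous_parabolaKernel {χ : ℝ → ℝ} {f : ℝ → ℂ} (hχ : Continuous χ)
    (hf : Continuous f) : Continuous (Function.uncurry (parabolaKernel χ f)) := by
  unfold Function.uncurry parabolaKernel
  fun_prop

/-- The point `(x, y)` is a continuous function of `(x + (y - x)², y - x)`, so the support lies in a
continuous image of `tsupport f × tsupport χ`. -/
theorem hasCompactSupport_parabolaKernel {χ : ℝ → ℝ} {f : ℝ → ℂ} (hχ : HasCompactSupport χ)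
    (hf : HasCompactSupport f) : HasCompactSupport (Function.uncurry (parabolaKernel χ f)) := by
  refine HasCompactSupport.intro (K := (fun p : ℝ × ℝ => (p.1 - p.2 ^ 2, p.1 - p.2 ^ 2 + p.2)) ''
    (tsupport f ×ˢ tsupport χ)) ((hf.isCompact.prod hχ.isCompact).image (by fun_prop)) ?_
  rintro ⟨x, y⟩ hxy
  by_contra h
  have h' : f (x + (y - x) ^ 2) * (χ (y - x) : ℂ) ≠ 0 := h
  refine hxy ⟨(x + (y - x) ^ 2, y - x), ⟨subset_tsupport _ (left_ne_zero_of_mul h'),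
    subset_tsupport _ ?_⟩, by simp⟩
  exact_mod_cast right_ne_zero_of_mul h'

/-- Invariance of a double integral under a translation depending on the other variable. -/
theorem integral_prod_shear {α : Type*} [MeasurableSpace α] {μ : Measure α} [SFinite μ]
    {G : ℝ × α → ℂ} (s : α → ℝ) (hG : Integrable G (volume.prod μ))
    (hGs : Integrable (fun w => G (w.1 + s w.2, w.2)) (volume.prod μ)) :
    ∫ w, G w ∂(volume.prod μ) = ∫ w, G (w.1 + s w.2, w.2) ∂(volume.prod μ) := by
  rw [integral_prod_symm _ hG, integral_prod_symm _ hGs]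
  refine integral_congr_ae (Filter.Eventually.of_forall fun z => ?_)
  exact (integral_add_right_eq_self (fun y => G (y, z)) (s z)).symm

/-- Fubini's theorem for continuous compactly supported functions of four variables. -/
theorem integral_four_of_hasCompactSupport {G : ℝ × ℝ × ℝ × ℝ → ℂ} (hG : Continuous G)
    (hGs : HasCompactSupport G) :
    ∫ w, G w = ∫ y, ∫ k, ∫ t, ∫ l, G (y, k, t, l) := by
  have e : ∀ y : ℝ, Topology.IsClosedEmbedding (fun z : ℝ × ℝ × ℝ => (y, z)) := fun y =>
    Topology.IsClosedEmbedding.of_continuous_injective_isClosedMap (by fun_prop)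
      (Prod.mk_right_injective y) (isClosedMap_prodMk_left y)
  have e' : ∀ y : ℝ, Topology.IsClosedEmbedding (fun z : ℝ × ℝ => (y, z)) := fun y =>
    Topology.IsClosedEmbedding.of_continuous_injective_isClosedMap (by fun_prop)
      (Prod.mk_right_injective y) (isClosedMap_prodMk_left y)
  rw [Measure.volume_eq_prod, integral_prod _ (hG.integrable_of_hasCompactSupport hGs)]
  congr 1
  ext y
  have c1 : Continuous fun z : ℝ × ℝ × ℝ => G (y, z) := by fun_prop
  have s1 : HasCompactSupport fun z : ℝ × ℝ × ℝ => G (y, z) := hGs.comp_isClosedEmbedding (e y)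
  rw [Measure.volume_eq_prod, integral_prod _ (c1.integrable_of_hasCompactSupport s1)]
  congr 1
  ext k
  have c2 : Continuous fun z : ℝ × ℝ => G (y, k, z) := by fun_prop
  have s2 : HasCompactSupport fun z : ℝ × ℝ => G (y, k, z) := s1.comp_isClosedEmbedding (e' k)
  rw [Measure.volume_eq_prod, integral_prod _ (c2.integrable_of_hasCompactSupport s2)]

/-- The box form of the kernel, written in variables in which it is a form in translates of `f`. -/
theorem box_integral_eq {χ : ℝ → ℝ} {f : ℝ → ℂ} (hχ : Continuous χ) (hχs : HasCompactSupport χ)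
    (hf : Continuous f) (hfs : HasCompactSupport f) :
    ((∫ p : ℝ × ℝ, ‖∫ x, parabolaKernel χ f x p.1 * conj (parabolaKernel χ f x p.2)‖ ^ 2 : ℝ) : ℂ) =
      ∫ w : ℝ × ℝ × ℝ × ℝ, (boxCutoff χ w.2 : ℂ) * (f w.1 * conj (f (w.1 + shiftA w.2)) *
        conj (f (w.1 + shiftB w.2)) * f (w.1 + shiftC w.2)) := by
  set κ := parabolaKernel χ f with hκ
  have hk : Continuous (Function.uncurry κ) := continuous_parabolaKernel hχ hf
  have hks : HasCompactSupport (Function.uncurry κ) := hasCompactSupport_parabolaKernel hχs hfs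
  obtain ⟨S, hS, hS0⟩ := exists_square_of_hasCompactSupport hks
  obtain ⟨hBc, hBs⟩ := continuous_kernel_comp hk hks
  set B : ℝ × ℝ → ℂ := fun p => ∫ x, κ x p.1 * conj (κ x p.2) with hB
  have hkc : ∀ {u v : ℝ × ℝ × ℝ × ℝ → ℝ}, Continuous u → Continuous v →
      Continuous fun w => κ (u w) (v w) := fun hu hv => hk.comp (hu.prodMk hv)
  -- The expanded square in the variables `y' = y + k`, `x = y - t`, `x' = y - (t + l)`: the four
  -- differences of a `y` and an `x` become `t`, `t + k`, `t + l`, `t + k + l`.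
  set G : ℝ × ℝ × ℝ × ℝ → ℂ := fun w =>
    (κ (w.1 - w.2.2.1) w.1 * conj (κ (w.1 - w.2.2.1) (w.1 + w.2.1))) *
      conj (κ (w.1 - (w.2.2.1 + w.2.2.2)) w.1 *
        conj (κ (w.1 - (w.2.2.1 + w.2.2.2)) (w.1 + w.2.1))) with hG
  have hGc : Continuous G := by
    have a1 : Continuous fun w : ℝ × ℝ × ℝ × ℝ => κ (w.1 - w.2.2.1) w.1 :=
      hkc (by fun_prop) (by fun_prop)
    have a2 : Continuous fun w : ℝ × ℝ × ℝ × ℝ => κ (w.1 - w.2.2.1) (w.1 + w.2.1) :=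
      hkc (by fun_prop) (by fun_prop)
    have a3 : Continuous fun w : ℝ × ℝ × ℝ × ℝ => κ (w.1 - (w.2.2.1 + w.2.2.2)) w.1 :=
      hkc (by fun_prop) (by fun_prop)
    have a4 : Continuous fun w : ℝ × ℝ × ℝ × ℝ => κ (w.1 - (w.2.2.1 + w.2.2.2)) (w.1 + w.2.1) :=
      hkc (by fun_prop) (by fun_prop)
    have cc := Complex.continuous_conj
    exact (a1.mul (cc.comp a2)).mul (cc.comp (a3.mul (cc.comp a4)))
  have hGs : HasCompactSupport G := by
    refine HasCompactSupport.intro (K := (fun p : ℝ × ℝ × ℝ × ℝ =>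
      (p.1, p.2.1 - p.1, p.1 - p.2.2.1, p.2.2.1 - p.2.2.2)) '' (S ×ˢ S ×ˢ S ×ˢ S))
      ((hS.prod (hS.prod (hS.prod hS))).image (by fun_prop)) ?_
    rintro ⟨y, k, t, l⟩ hw
    by_contra h
    have h1 : y ∈ S := by
      by_contra hy
      exact h (by simp [hG, hS0 _ _ (Or.inr hy)])
    have h2 : y + k ∈ S := by
      by_contra hy
      exact h (by simp [hG, hS0 _ _ (Or.inr hy)])
    have h3 : y - t ∈ S := by
      by_contra hy
      exact h (by simp [hG, hS0 _ _ (Or.inl hy)])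
    have h4 : y - (t + l) ∈ S := by
      by_contra hy
      exact h (by simp [hG, hS0 _ _ (Or.inl hy)])
    exact hw ⟨(y, y + k, y - t, y - (t + l)), ⟨h1, h2, h3, h4⟩, by simp⟩
  have hBG : ∀ y k, ((‖B (y, y + k)‖ ^ 2 : ℝ) : ℂ) = ∫ t, ∫ l, G (y, k, t, l) := by
    intro y k
    have e1 : B (y, y + k) = ∫ t, κ (y - t) y * conj (κ (y - t) (y + k)) :=
      (integral_sub_left_eq_self (fun x => κ x y * conj (κ x (y + k))) volume y).symm
    have e2 : ∀ t, conj (B (y, y + k)) = ∫ l, conj (κ (y - (t + l)) y *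
        conj (κ (y - (t + l)) (y + k))) := by
      intro t
      rw [e1, ← integral_conj]
      exact (integral_add_left_eq_self (fun x => conj (κ (y - x) y * conj (κ (y - x) (y + k)))) t).symm
    have e3 : ((‖B (y, y + k)‖ ^ 2 : ℝ) : ℂ) = B (y, y + k) * conj (B (y, y + k)) := by
      rw [Complex.mul_conj, Complex.normSq_eq_norm_sq]
    rw [e3]
    nth_rewrite 1 [e1]
    rw [← integral_mul_const]
    congr 1
    ext t
    rw [e2 t, ← integral_const_mul]
  have hB2 : Integrable (fun p : ℝ × ℝ => ‖B p‖ ^ 2) (volume.prod volume) :=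
    (hBc.memLp_of_hasCompactSupport (p := 2) hBs).norm.integrable_sq
  have main : ((∫ p : ℝ × ℝ, ‖B p‖ ^ 2 : ℝ) : ℂ) = ∫ w, G w := by
    rw [integral_four_of_hasCompactSupport hGc hGs, Measure.volume_eq_prod, integral_prod _ hB2,
      ← integral_complex_ofReal]
    congr 1
    ext y
    rw [← integral_add_left_eq_self (fun x => ‖B (y, x)‖ ^ 2) y, ← integral_complex_ofReal]
    simp only [hBG]
  rw [main]
  have hGi : Integrable G (volume.prod volume) := hGc.integrable_of_hasCompactSupport hGs
  -- The first factor is `f` at `y - t + t²`. This shear makes that point the base variable `v`.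
  let e : ℝ × ℝ × ℝ × ℝ ≃ₜ ℝ × ℝ × ℝ × ℝ :=
    { toFun := fun w => (w.1 + (w.2.2.1 - w.2.2.1 ^ 2), w.2)
      invFun := fun w => (w.1 - (w.2.2.1 - w.2.2.1 ^ 2), w.2)
      left_inv := fun w => by simp
      right_inv := fun w => by simp
      continuous_toFun := by fun_prop
      continuous_invFun := by fun_prop }
  have hGe : Integrable (fun w => G (e w)) (volume.prod volume) :=
    (hGc.comp e.continuous).integrable_of_hasCompactSupport (hGs.comp_homeomorph e)
  have hswap : ∫ w, G w = ∫ w, G (e w) := by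
    exact integral_prod_shear (fun z : ℝ × ℝ × ℝ => z.2.1 - z.2.1 ^ 2) hGi hGe
  rw [hswap]
  congr 1
  ext w
  obtain ⟨v, k, t, l⟩ := w
  have q1 : v + (t - t ^ 2) - (v + (t - t ^ 2) - t) = t := by ring
  have q2 : v + (t - t ^ 2) + k - (v + (t - t ^ 2) - t) = t + k := by ring
  have q3 : v + (t - t ^ 2) - (v + (t - t ^ 2) - (t + l)) = t + l := by ring
  have q4 : v + (t - t ^ 2) + k - (v + (t - t ^ 2) - (t + l)) = t + k + l := by ring
  have he : e (v, k, t, l) = (v + (t - t ^ 2), k, t, l) := rfl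
  simp only [he, hG, hκ, parabolaKernel, boxCutoff, shiftA, shiftB, shiftC, q1, q2, q3, q4, map_mul, Complex.conj_conj, Complex.conj_ofReal,
    Complex.ofReal_mul]
  ring_nf

end BoxForm

/-! ### Absolute bounds for the box form by pairing its factors. -/

section PairBounds

theorem lintegral_triple {W : ℝ × ℝ × ℝ → ℝ≥0∞} (hW : Measurable W) :
    ∫⁻ z, W z = ∫⁻ p, ∫⁻ q, ∫⁻ l, W (p, q, l) := by
  rw [Measure.volume_eq_prod, lintegral_prod _ hW.aemeasurable]
  refine lintegral_congr fun p => ?_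
  rw [Measure.volume_eq_prod, lintegral_prod _ (by fun_prop)]

/-- The linear map `(k, t, l) ↦ (p, q, l)` with `p = t`, `q = t + k + l` is unimodular. In these
coordinates `shiftC` is `q² - l - p²`. -/
theorem lintegral_comp_pair_one {W : ℝ × ℝ × ℝ → ℝ≥0∞} (hW : Measurable W) :
    ∫⁻ z : ℝ × ℝ × ℝ, W (z.2.1, z.2.1 + z.1 + z.2.2, z.2.2) = ∫⁻ z, W z := by
  rw [lintegral_triple hW, Measure.volume_eq_prod, lintegral_prod_symm _ (by fun_prop),
    Measure.volume_eq_prod, lintegral_prod _ (by fun_prop)]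
  refine lintegral_congr fun t => ?_
  have h : ∀ l : ℝ, ∫⁻ k, W (t, t + k + l, l) = ∫⁻ q, W (t, q, l) := fun l => by
    rw [← lintegral_add_right_eq_self (fun q => W (t, q, l)) (t + l)]
    refine lintegral_congr fun k => ?_
    congr 3
    ring
  simp only [h]
  exact lintegral_lintegral_swap (by fun_prop)

/-- Also unimodular, now with `p = t + k`, `q = t + l`. In these coordinates `shiftB - shiftA` is
again `q² - l - p²`, so both pairs of factors reduce to the same estimate. -/
theorem lintegral_comp_pair_two {W : ℝ × ℝ × ℝ → ℝ≥0∞} (hW : Measurable W) :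
    ∫⁻ z : ℝ × ℝ × ℝ, W (z.2.1 + z.1, z.2.1 + z.2.2, z.2.2) = ∫⁻ z, W z := by
  rw [Measure.volume_eq_prod, lintegral_prod_symm _ (by fun_prop),
    lintegral_prod_symm _ (by fun_prop)]
  have h : ∀ p : ℝ × ℝ, ∫⁻ k, W (p.1 + k, p.1 + p.2, p.2) = ∫⁻ k, W (k, p.1 + p.2, p.2) :=
    fun p => lintegral_add_left_eq_self (fun k => W (k, p.1 + p.2, p.2)) p.1
  simp only [h]
  rw [Measure.volume_eq_prod, lintegral_prod_symm _ (by fun_prop),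
    lintegral_prod_symm _ (by fun_prop)]
  refine lintegral_congr fun l => ?_
  exact lintegral_add_right_eq_self (fun t => ∫⁻ k, W (k, t, l)) l

/-- For fixed `p`, `q` the argument `u` of `F` is a reflected translate of `l`. Using `u` in place
of `l` turns `l` into `c + q² - p²` with `c = v - u`; the weight is then integrated over `(p, q)`
for fixed `u`, which explains the shape of `hM`. -/
theorem lintegral_pair_le {w : ℝ × ℝ × ℝ → ℝ≥0∞} (hw : Measurable w) {M : ℝ≥0∞}
    (hM : ∀ c : ℝ, ∫⁻ p : ℝ × ℝ, w (p.1, p.2, c + p.2 ^ 2 - p.1 ^ 2) ≤ M) {F : ℝ → ℝ≥0∞}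
    (hF : Measurable F) (v : ℝ) :
    ∫⁻ z : ℝ × ℝ × ℝ, w z * F (v + (z.2.1 ^ 2 - z.2.2 - z.1 ^ 2)) ≤ M * ∫⁻ u, F u := by
  calc ∫⁻ z : ℝ × ℝ × ℝ, w z * F (v + (z.2.1 ^ 2 - z.2.2 - z.1 ^ 2))
      = ∫⁻ p, ∫⁻ q, ∫⁻ l, w (p, q, l) * F (v + (q ^ 2 - l - p ^ 2)) :=
        lintegral_triple (by fun_prop)
    _ = ∫⁻ p, ∫⁻ q, ∫⁻ u, w (p, q, v - u + q ^ 2 - p ^ 2) * F u := by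
        refine lintegral_congr fun p => lintegral_congr fun q => ?_
        rw [← lintegral_sub_left_eq_self _ (v + q ^ 2 - p ^ 2)]
        refine lintegral_congr fun u => ?_
        congr 3 <;> ring_nf
    _ = ∫⁻ p : ℝ × ℝ, ∫⁻ u, w (p.1, p.2, v - u + p.2 ^ 2 - p.1 ^ 2) * F u := by
        rw [Measure.volume_eq_prod, lintegral_prod _ (by fun_prop)]
    _ = ∫⁻ u, ∫⁻ p : ℝ × ℝ, w (p.1, p.2, v - u + p.2 ^ 2 - p.1 ^ 2) * F u :=
        lintegral_lintegral_swap (by fun_prop)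
    _ = ∫⁻ u, (∫⁻ p : ℝ × ℝ, w (p.1, p.2, v - u + p.2 ^ 2 - p.1 ^ 2)) * F u := by
        refine lintegral_congr fun u => ?_
        rw [lintegral_mul_const _ (by fun_prop)]
    _ ≤ ∫⁻ u, M * F u := lintegral_mono fun u => by gcongr; exact hM _
    _ = M * ∫⁻ u, F u := lintegral_const_mul _ hF

theorem continuous_shiftA : Continuous shiftA := by unfold shiftA; fun_prop
theorem continuous_shiftB : Continuous shiftB := by unfold shiftB; fun_prop
theorem continuous_shiftC : Continuous shiftC := by unfold shiftC; fun_prop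

theorem lintegral_first_fourth_le {W w : ℝ × ℝ × ℝ → ℝ≥0∞} (hw : Measurable w) {M : ℝ≥0∞}
    (hM : ∀ c : ℝ, ∫⁻ p : ℝ × ℝ, w (p.1, p.2, c + p.2 ^ 2 - p.1 ^ 2) ≤ M)
    (hW : ∀ z, W z ≤ w (z.2.1, z.2.1 + z.1 + z.2.2, z.2.2)) {F G : ℝ → ℝ≥0∞}
    (hF : Measurable F) (hG : Measurable G) :
    ∫⁻ v, ∫⁻ z, W z * (F v * G (v + shiftC z)) ≤ M * ((∫⁻ u, F u) * ∫⁻ u, G u) := by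
  calc ∫⁻ v, ∫⁻ z, W z * (F v * G (v + shiftC z))
      ≤ ∫⁻ v, F v * (M * ∫⁻ u, G u) := by
        refine lintegral_mono fun v => ?_
        calc ∫⁻ z, W z * (F v * G (v + shiftC z))
            ≤ ∫⁻ z : ℝ × ℝ × ℝ, F v * (w (z.2.1, z.2.1 + z.1 + z.2.2, z.2.2) *
                G (v + shiftC z)) := by
              refine lintegral_mono fun z => ?_
              rw [mul_left_comm]
              gcongr
              exact hW z
          _ = F v * ∫⁻ z : ℝ × ℝ × ℝ, w (z.2.1, z.2.1 + z.1 + z.2.2, z.2.2) *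
                G (v + shiftC z) := by
              have := continuous_shiftC.measurable
              rw [lintegral_const_mul _ (by fun_prop)]
          _ = F v * ∫⁻ z : ℝ × ℝ × ℝ, w z * G (v + (z.2.1 ^ 2 - z.2.2 - z.1 ^ 2)) := by
              rw [← lintegral_comp_pair_one
                (W := fun z => w z * G (v + (z.2.1 ^ 2 - z.2.2 - z.1 ^ 2))) (by fun_prop)]
              rfl
          _ ≤ F v * (M * ∫⁻ u, G u) := by
              gcongr
              exact lintegral_pair_le hw hM hG v
    _ = M * ((∫⁻ u, F u) * ∫⁻ u, G u) := by
        rw [lintegral_mul_const _ hF]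
        ring

/-- Translating `v` by `shiftA z` moves the second factor to the base point and the third to
distance `shiftB z - shiftA z`; the rest is as for the first and fourth factors. -/
theorem lintegral_second_third_le {W w : ℝ × ℝ × ℝ → ℝ≥0∞} (hWm : Measurable W)
    (hw : Measurable w) {M : ℝ≥0∞}
    (hM : ∀ c : ℝ, ∫⁻ p : ℝ × ℝ, w (p.1, p.2, c + p.2 ^ 2 - p.1 ^ 2) ≤ M)
    (hW : ∀ z, W z ≤ w (z.2.1 + z.1, z.2.1 + z.2.2, z.2.2)) {F G : ℝ → ℝ≥0∞}
    (hF : Measurable F) (hG : Measurable G) :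
    ∫⁻ v, ∫⁻ z, W z * (F (v + shiftA z) * G (v + shiftB z)) ≤
      M * ((∫⁻ u, F u) * ∫⁻ u, G u) := by
  have hA := continuous_shiftA.measurable
  have hB := continuous_shiftB.measurable
  calc ∫⁻ v, ∫⁻ z, W z * (F (v + shiftA z) * G (v + shiftB z))
      = ∫⁻ z, ∫⁻ v, W z * (F (v + shiftA z) * G (v + shiftB z)) :=
        lintegral_lintegral_swap (by fun_prop)
    _ = ∫⁻ z, ∫⁻ v, W z * (F v * G (v + (shiftB z - shiftA z))) := by
        refine lintegral_congr fun z => ?_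
        rw [← lintegral_add_right_eq_self
          (fun v => W z * (F v * G (v + (shiftB z - shiftA z)))) (shiftA z)]
        refine lintegral_congr fun v => ?_
        congr 3
        ring
    _ = ∫⁻ v, ∫⁻ z, W z * (F v * G (v + (shiftB z - shiftA z))) :=
        lintegral_lintegral_swap (by fun_prop)
    _ ≤ ∫⁻ v, F v * (M * ∫⁻ u, G u) := by
        refine lintegral_mono fun v => ?_
        calc ∫⁻ z, W z * (F v * G (v + (shiftB z - shiftA z)))
            ≤ ∫⁻ z : ℝ × ℝ × ℝ, F v * (w (z.2.1 + z.1, z.2.1 + z.2.2, z.2.2) *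
                G (v + (shiftB z - shiftA z))) := by
              refine lintegral_mono fun z => ?_
              rw [mul_left_comm]
              gcongr
              exact hW z
          _ = F v * ∫⁻ z : ℝ × ℝ × ℝ, w (z.2.1 + z.1, z.2.1 + z.2.2, z.2.2) *
                G (v + (shiftB z - shiftA z)) := by
              rw [lintegral_const_mul _ (by fun_prop)]
          _ = F v * ∫⁻ z : ℝ × ℝ × ℝ, w z * G (v + (z.2.1 ^ 2 - z.2.2 - z.1 ^ 2)) := by
              rw [← lintegral_comp_pair_two
                (W := fun z => w z * G (v + (z.2.1 ^ 2 - z.2.2 - z.1 ^ 2))) (by fun_prop)]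
              congr 1
              refine lintegral_congr fun z => ?_
              congr 3
              simp only [shiftA, shiftB]
              ring
          _ ≤ F v * (M * ∫⁻ u, G u) := by
              gcongr
              exact lintegral_pair_le hw hM hG v
    _ = M * ((∫⁻ u, F u) * ∫⁻ u, G u) := by
        rw [lintegral_mul_const _ hF]
        ring

/-- The absolute bound for the box form with a weight that is controlled in both of the coordinate
systems `(t, t + k + l, l)` and `(t + k, t + l, l)`. -/
theorem lintegral_box_le {W w : ℝ × ℝ × ℝ → ℝ≥0∞} (hWm : Measurable W) (hw : Measurable w)
    {M : ℝ≥0∞} (hM : ∀ c : ℝ, ∫⁻ p : ℝ × ℝ, w (p.1, p.2, c + p.2 ^ 2 - p.1 ^ 2) ≤ M)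
    (hW₁ : ∀ z, W z ≤ w (z.2.1, z.2.1 + z.1 + z.2.2, z.2.2))
    (hW₂ : ∀ z, W z ≤ w (z.2.1 + z.1, z.2.1 + z.2.2, z.2.2)) {F₁ F₂ F₃ F₄ : ℝ → ℝ≥0∞}
    (h₁ : Measurable F₁) (h₂ : Measurable F₂) (h₃ : Measurable F₃) (h₄ : Measurable F₄) :
    ∫⁻ v, ∫⁻ z, W z * (F₁ v * F₂ (v + shiftA z) * F₃ (v + shiftB z) * F₄ (v + shiftC z)) ≤
      M * ((∫⁻ u, F₁ u ^ 2) ^ (1 / 2 : ℝ) * (∫⁻ u, F₂ u ^ 2) ^ (1 / 2 : ℝ) *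
        (∫⁻ u, F₃ u ^ 2) ^ (1 / 2 : ℝ) * (∫⁻ u, F₄ u ^ 2) ^ (1 / 2 : ℝ)) := by
  have hA := continuous_shiftA.measurable
  have hB := continuous_shiftB.measurable
  have hC := continuous_shiftC.measurable
  have half : (1 / 2 : ℝ) + 1 / 2 = 1 := by norm_num
  have hsq : ∀ x : ℝ≥0∞, (x ^ (1 / 2 : ℝ)) ^ (2 : ℝ) = x := fun x => by
    rw [← ENNReal.rpow_mul]; norm_num
  have hmul : ∀ x : ℝ≥0∞, x ^ (1 / 2 : ℝ) * x ^ (1 / 2 : ℝ) = x := fun x => by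
    rw [← ENNReal.rpow_add_of_nonneg _ _ (by norm_num) (by norm_num), half, ENNReal.rpow_one]
  -- Half of the weight goes to each pair of factors, so that both squares in Cauchy-Schwarz carry
  -- the full `W`.
  let G₁ : ℝ × (ℝ × ℝ × ℝ) → ℝ≥0∞ := fun y => W y.2 ^ (1 / 2 : ℝ) * (F₁ y.1 * F₄ (y.1 + shiftC y.2))
  let G₂ : ℝ × (ℝ × ℝ × ℝ) → ℝ≥0∞ := fun y =>
    W y.2 ^ (1 / 2 : ℝ) * (F₂ (y.1 + shiftA y.2) * F₃ (y.1 + shiftB y.2))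
  have hG₁ : Measurable G₁ := by fun_prop
  have hG₂ : Measurable G₂ := by fun_prop
  have hCS := ENNReal.lintegral_mul_le_Lp_mul_Lq (volume.prod volume) Real.HolderConjugate.two_two
    hG₁.aemeasurable hG₂.aemeasurable
  have e₁ : ∫⁻ y, G₁ y ^ (2 : ℝ) ∂(volume.prod volume) ≤
      M * ((∫⁻ u, F₁ u ^ 2) * ∫⁻ u, F₄ u ^ 2) := by
    rw [lintegral_prod _ (by fun_prop)]
    refine le_trans (le_of_eq ?_) (lintegral_first_fourth_le hw hM hW₁ (F := fun u => F₁ u ^ 2)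
      (G := fun u => F₄ u ^ 2) (by fun_prop) (by fun_prop))
    refine lintegral_congr fun v => lintegral_congr fun z => ?_
    simp only [G₁]
    rw [ENNReal.mul_rpow_of_nonneg _ _ (by norm_num), hsq, ENNReal.rpow_two, mul_pow]
  have e₂ : ∫⁻ y, G₂ y ^ (2 : ℝ) ∂(volume.prod volume) ≤
      M * ((∫⁻ u, F₂ u ^ 2) * ∫⁻ u, F₃ u ^ 2) := by
    rw [lintegral_prod _ (by fun_prop)]
    refine le_trans (le_of_eq ?_) (lintegral_second_third_le hWm hw hM hW₂
      (F := fun u => F₂ u ^ 2) (G := fun u => F₃ u ^ 2) (by fun_prop) (by fun_prop))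
    refine lintegral_congr fun v => lintegral_congr fun z => ?_
    simp only [G₂]
    rw [ENNReal.mul_rpow_of_nonneg _ _ (by norm_num), hsq, ENNReal.rpow_two, mul_pow]
  calc ∫⁻ v, ∫⁻ z, W z * (F₁ v * F₂ (v + shiftA z) * F₃ (v + shiftB z) * F₄ (v + shiftC z))
      = ∫⁻ y, (G₁ * G₂) y ∂(volume.prod volume) := by
        rw [lintegral_prod _ (by fun_prop)]
        refine lintegral_congr fun v => lintegral_congr fun z => ?_
        simp only [G₁, G₂, Pi.mul_apply]
        nth_rewrite 1 [← hmul (W z)]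
        ring
    _ ≤ _ := hCS
    _ ≤ (M * ((∫⁻ u, F₁ u ^ 2) * ∫⁻ u, F₄ u ^ 2)) ^ (1 / 2 : ℝ) *
        (M * ((∫⁻ u, F₂ u ^ 2) * ∫⁻ u, F₃ u ^ 2)) ^ (1 / 2 : ℝ) := by gcongr
    _ = _ := by
        have hn : (0 : ℝ) ≤ 1 / 2 := by norm_num
        simp only [ENNReal.mul_rpow_of_nonneg _ _ hn]
        nth_rewrite 3 [← hmul M]
        ring

end PairBounds

/-! ### Smallness near the degenerate set. -/

section Weights

/-- The set of `(p, q, l)` with `|p|, |q| ≤ R`. -/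
def squareSet (R : ℝ) : Set (ℝ × ℝ × ℝ) := {y | |y.1| ≤ R ∧ |y.2.1| ≤ R}

/-- The set of `(k, t, l)` for which the four cutoffs have arguments in `[-R, R]`. -/
def boxSet (R : ℝ) : Set (ℝ × ℝ × ℝ) :=
  {z | |z.2.1| ≤ R ∧ |z.2.1 + z.1| ≤ R ∧ |z.2.1 + z.2.2| ≤ R ∧ |z.2.1 + z.1 + z.2.2| ≤ R}

/-- The set of `(p, q, l)` near which the change of variables in the box form degenerates. -/
def degenerateSet (ρ : ℝ) : Set (ℝ × ℝ × ℝ) :=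
  {y | |y.2.2| < ρ ∨ |y.2.1 - y.1 - y.2.2| < ρ ∨ |2 * (y.1 + y.2.1) - 1| < ρ}

/-- The set lies in two symmetric intervals, each of length `√(a + ρ) - √(a - ρ) ≤ √(2ρ)`. The
square root of `ρ`, rather than `ρ`, comes from `a` near `0`, where `q ↦ q²` is stationary. -/
theorem volume_abs_sq_sub_lt_le (a ρ : ℝ) :
    volume {q : ℝ | |q ^ 2 - a| < ρ} ≤ ENNReal.ofReal (4 * √ρ) := by
  rcases le_or_gt ρ 0 with hρ | hρ
  · have : {q : ℝ | |q ^ 2 - a| < ρ} = ∅ := by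
      ext q
      simpa using hρ.trans (abs_nonneg _)
    simp [this]
  -- For `a < ρ` this root is `0` by convention, and the two intervals then meet at the origin, as
  -- they should.
  set s := √(a - ρ) with hs
  set s' := √(a + ρ) with hs'
  have hsub : {q : ℝ | |q ^ 2 - a| < ρ} ⊆ Set.Icc s s' ∪ Set.Icc (-s') (-s) := by
    intro q hq
    have hq' : |q ^ 2 - a| < ρ := hq
    rw [abs_lt] at hq'
    have h1 : s ≤ |q| := Real.sqrt_le_iff.2 ⟨abs_nonneg _, by rw [sq_abs]; linarith⟩
    have h2 : |q| ≤ s' := Real.le_sqrt_of_sq_le (by rw [sq_abs]; linarith)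
    rcases abs_cases q with ⟨h, -⟩ | ⟨h, -⟩
    · left; constructor <;> linarith
    · right; constructor <;> linarith
  have hdiff : s' - s ≤ 2 * √ρ := by
    have h1 : s' ≤ s + √(2 * ρ) := by
      refine Real.sqrt_le_iff.2 ⟨by positivity, ?_⟩
      have e1 : √(2 * ρ) ^ 2 = 2 * ρ := Real.sq_sqrt (by linarith)
      have e2 : a - ρ ≤ s ^ 2 := by
        rcases le_or_gt 0 (a - ρ) with h | h
        · exact (Real.sq_sqrt h).ge
        · nlinarith [sq_nonneg s]
      nlinarith [mul_nonneg (Real.sqrt_nonneg (a - ρ)) (Real.sqrt_nonneg (2 * ρ))]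
    have h2 : √(2 * ρ) ≤ 2 * √ρ := by
      refine Real.sqrt_le_iff.2 ⟨by positivity, ?_⟩
      rw [mul_pow, Real.sq_sqrt hρ.le]
      linarith
    linarith
  calc volume {q : ℝ | |q ^ 2 - a| < ρ} ≤ volume (Set.Icc s s' ∪ Set.Icc (-s') (-s)) :=
        measure_mono hsub
    _ ≤ volume (Set.Icc s s') + volume (Set.Icc (-s') (-s)) := measure_union_le _ _
    _ = ENNReal.ofReal (s' - s) + ENNReal.ofReal (s' - s) := by
        rw [Real.volume_Icc, Real.volume_Icc]
        congr 2
        ring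
    _ ≤ ENNReal.ofReal (2 * √ρ) + ENNReal.ofReal (2 * √ρ) := by gcongr
    _ = ENNReal.ofReal (4 * √ρ) := by
        rw [← ENNReal.ofReal_add (by positivity) (by positivity)]
        congr 1
        ring

theorem measurableSet_squareSet (R : ℝ) : MeasurableSet (squareSet R) := by
  have h : ∀ u : ℝ × ℝ × ℝ → ℝ, Continuous u → MeasurableSet {y | |u y| ≤ R} := fun u hu =>
    (isClosed_le hu.abs continuous_const).measurableSet
  exact (h _ (by fun_prop)).inter (h _ (by fun_prop))

theorem isClosed_boxSet (R : ℝ) : IsClosed (boxSet R) := by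
  have h : ∀ u : ℝ × ℝ × ℝ → ℝ, Continuous u → IsClosed {y | |u y| ≤ R} := fun u hu =>
    isClosed_le hu.abs continuous_const
  exact (h _ (by fun_prop)).inter ((h _ (by fun_prop)).inter
    ((h _ (by fun_prop)).inter (h _ (by fun_prop))))

theorem measurableSet_degenerateSet (ρ : ℝ) : MeasurableSet (degenerateSet ρ) := by
  have h : ∀ u : ℝ × ℝ × ℝ → ℝ, Continuous u → MeasurableSet {y | |u y| < ρ} := fun u hu =>
    (isOpen_lt hu.abs continuous_const).measurableSet
  exact (h _ (by fun_prop)).union ((h _ (by fun_prop)).union (h _ (by fun_prop)))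

/-- The weight `ρ² + 1_{degenerate}` on the square. -/
noncomputable def degenerateWeight (R ρ : ℝ) (y : ℝ × ℝ × ℝ) : ℝ≥0∞ :=
  (squareSet R).indicator (fun _ => ENNReal.ofReal (ρ ^ 2)) y +
    (squareSet R ∩ degenerateSet ρ).indicator (fun _ => 1) y

theorem measurable_degenerateWeight (R ρ : ℝ) : Measurable (degenerateWeight R ρ) := by
  unfold degenerateWeight
  exact (measurable_const.indicator (measurableSet_squareSet R)).add
    (measurable_const.indicator ((measurableSet_squareSet R).inter (measurableSet_degenerateSet ρ)))

theorem lintegral_squareSet_le (R : ℝ) (hR : 0 ≤ R) (c : ℝ) (m : ℝ≥0∞) :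
    ∫⁻ p : ℝ × ℝ, (squareSet R).indicator (fun _ => m) (p.1, p.2, c + p.2 ^ 2 - p.1 ^ 2) ≤
      m * ENNReal.ofReal (4 * R ^ 2) := by
  have : ∀ p : ℝ × ℝ, (squareSet R).indicator (fun _ => m) (p.1, p.2, c + p.2 ^ 2 - p.1 ^ 2) =
      (Set.Icc (-R) R ×ˢ Set.Icc (-R) R).indicator (fun _ => m) p := by
    intro p
    unfold Set.indicator squareSet
    simp only [abs_le, Set.mem_prod, Set.mem_Icc]
    rfl
  simp only [this]
  rw [lintegral_indicator (measurableSet_Icc.prod measurableSet_Icc), setLIntegral_const,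
    Measure.volume_eq_prod, Measure.prod_prod, Real.volume_Icc,
    ← ENNReal.ofReal_mul (by linarith)]
  apply le_of_eq
  congr 2
  ring

/-- On the surface `l = c + q² - p²` with `p` fixed, the first two degeneracy conditions confine a
monic quadratic in `q` (up to sign) to an interval of length `2ρ`, after completing the square in
the second. The third is linear in `q`. The constant is `4 + 4 + 1`, using `ρ ≤ √ρ`. -/
theorem volume_degenerate_slice_le {ρ : ℝ} (hρ : 0 < ρ) (hρ1 : ρ ≤ 1) (c p : ℝ) :
    volume {q : ℝ | (p, q, c + q ^ 2 - p ^ 2) ∈ degenerateSet ρ} ≤ ENNReal.ofReal (9 * √ρ) := by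
  have h2 : {q : ℝ | |q - p - (c + q ^ 2 - p ^ 2)| < ρ} =
      (fun q => q + -(1 / 2)) ⁻¹' {q : ℝ | |q ^ 2 - (1 / 4 - p - c + p ^ 2)| < ρ} := by
    ext q
    simp only [Set.mem_ofPred_eq, Set.mem_preimage]
    rw [← abs_neg]
    ring_nf
  have h3 : {q : ℝ | |2 * (p + q) - 1| < ρ} ⊆
      Set.Icc (1 / 2 - p - ρ / 2) (1 / 2 - p + ρ / 2) := by
    intro q hq
    have hq' : |2 * (p + q) - 1| < ρ := hq
    rw [abs_lt] at hq'
    constructor <;> linarith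
  have h1 : {q : ℝ | |c + q ^ 2 - p ^ 2| < ρ} = {q : ℝ | |q ^ 2 - (p ^ 2 - c)| < ρ} := by
    ext q
    simp only [Set.mem_ofPred_eq]
    ring_nf
  calc volume {q : ℝ | (p, q, c + q ^ 2 - p ^ 2) ∈ degenerateSet ρ}
      ≤ volume ({q : ℝ | |c + q ^ 2 - p ^ 2| < ρ} ∪
          ({q : ℝ | |q - p - (c + q ^ 2 - p ^ 2)| < ρ} ∪ {q : ℝ | |2 * (p + q) - 1| < ρ})) :=
        measure_mono fun q hq => hq
    _ ≤ volume {q : ℝ | |c + q ^ 2 - p ^ 2| < ρ} +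
          (volume {q : ℝ | |q - p - (c + q ^ 2 - p ^ 2)| < ρ} +
            volume {q : ℝ | |2 * (p + q) - 1| < ρ}) :=
        (measure_union_le _ _).trans (by gcongr; exact measure_union_le _ _)
    _ ≤ ENNReal.ofReal (4 * √ρ) + (ENNReal.ofReal (4 * √ρ) + ENNReal.ofReal ρ) := by
        gcongr
        · rw [h1]
          exact volume_abs_sq_sub_lt_le _ _
        · rw [h2, measure_preimage_add_right]
          exact volume_abs_sq_sub_lt_le _ _
        · refine (measure_mono h3).trans (le_of_eq ?_)
          rw [Real.volume_Icc]
          congr 1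
          ring
    _ ≤ ENNReal.ofReal (9 * √ρ) := by
        rw [← ENNReal.ofReal_add (by positivity) hρ.le,
          ← ENNReal.ofReal_add (by positivity) (by positivity)]
        apply ENNReal.ofReal_le_ofReal
        have : ρ ≤ √ρ := Real.le_sqrt_of_sq_le (by nlinarith)
        linarith

/-- The constant part contributes `ρ²` times the area `4R²` of the square, the indicator `9√ρ` for
each `p` in an interval of length `2R`. -/
theorem lintegral_degenerateWeight_le {R ρ : ℝ} (hR : 0 ≤ R) (hρ : 0 < ρ) (hρ1 : ρ ≤ 1) (c : ℝ) :
    ∫⁻ p : ℝ × ℝ, degenerateWeight R ρ (p.1, p.2, c + p.2 ^ 2 - p.1 ^ 2) ≤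
      ENNReal.ofReal ((4 * R ^ 2 + 18 * R) * √ρ) := by
  have hm : Measurable fun p : ℝ × ℝ => (p.1, p.2, c + p.2 ^ 2 - p.1 ^ 2) := by fun_prop
  have hsd : MeasurableSet (squareSet R ∩ degenerateSet ρ) :=
    (measurableSet_squareSet R).inter (measurableSet_degenerateSet ρ)
  unfold degenerateWeight
  have hm1 : Measurable fun p : ℝ × ℝ =>
      (squareSet R).indicator (fun _ => ENNReal.ofReal (ρ ^ 2)) (p.1, p.2, c + p.2 ^ 2 - p.1 ^ 2) :=
    (measurable_const.indicator (measurableSet_squareSet R)).comp hm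
  rw [lintegral_add_left hm1]
  have hsq : ρ ^ 2 ≤ √ρ := by
    refine Real.le_sqrt_of_sq_le ?_
    have h4 : (ρ ^ 2) ^ 2 = ρ ^ 4 := by ring
    rw [h4]
    exact pow_le_of_le_one hρ.le hρ1 (by norm_num)
  have second : ∫⁻ p : ℝ × ℝ, (squareSet R ∩ degenerateSet ρ).indicator (fun _ => (1 : ℝ≥0∞))
      (p.1, p.2, c + p.2 ^ 2 - p.1 ^ 2) ≤ ENNReal.ofReal (18 * R * √ρ) := by
    have hm2 : Measurable fun p : ℝ × ℝ => (squareSet R ∩ degenerateSet ρ).indicator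
        (fun _ => (1 : ℝ≥0∞)) (p.1, p.2, c + p.2 ^ 2 - p.1 ^ 2) :=
      (measurable_const.indicator hsd).comp hm
    rw [Measure.volume_eq_prod, lintegral_prod _ hm2.aemeasurable]
    calc ∫⁻ p, ∫⁻ q, (squareSet R ∩ degenerateSet ρ).indicator (fun _ => (1 : ℝ≥0∞))
          (p, q, c + q ^ 2 - p ^ 2)
        ≤ ∫⁻ p, (Set.Icc (-R) R).indicator (fun _ => ENNReal.ofReal (9 * √ρ)) p := by
          refine lintegral_mono fun p => ?_
          by_cases hp : p ∈ Set.Icc (-R) R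
          · rw [Set.indicator_of_mem hp]
            have hmp : Measurable fun q : ℝ => (p, q, c + q ^ 2 - p ^ 2) := by fun_prop
            have hset : MeasurableSet {q : ℝ | (p, q, c + q ^ 2 - p ^ 2) ∈ degenerateSet ρ} :=
              hmp (measurableSet_degenerateSet ρ)
            refine le_trans ?_ (volume_degenerate_slice_le hρ hρ1 c p)
            rw [← lintegral_indicator_one hset]
            refine lintegral_mono fun q => ?_
            by_cases hq : (p, q, c + q ^ 2 - p ^ 2) ∈ degenerateSet ρ
            · rw [Set.indicator_of_mem (s := {q : ℝ | (p, q, c + q ^ 2 - p ^ 2) ∈ degenerateSet ρ})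
                hq]
              exact Set.indicator_le_self _ _ _
            · rw [Set.indicator_of_notMem fun h => hq h.2]
              exact zero_le
          · have : ∀ q, (p, q, c + q ^ 2 - p ^ 2) ∉ squareSet R ∩ degenerateSet ρ :=
              fun q hq => hp (abs_le.1 hq.1.1)
            simp [this]
      _ = ENNReal.ofReal (9 * √ρ) * ENNReal.ofReal (R - -R) := by
          rw [lintegral_indicator measurableSet_Icc, setLIntegral_const, Real.volume_Icc]
      _ = ENNReal.ofReal (18 * R * √ρ) := by
          rw [← ENNReal.ofReal_mul (by positivity)]
          congr 1
          ring
  calc _ ≤ ENNReal.ofReal (ρ ^ 2) * ENNReal.ofReal (4 * R ^ 2) + ENNReal.ofReal (18 * R * √ρ) :=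
        add_le_add (lintegral_squareSet_le R hR c _) second
    _ ≤ _ := by
        rw [← ENNReal.ofReal_mul (by positivity),
          ← ENNReal.ofReal_add (by positivity) (by positivity)]
        apply ENNReal.ofReal_le_ofReal
        nlinarith [mul_le_mul_of_nonneg_right hsq (by positivity : (0 : ℝ) ≤ 4 * R ^ 2)]

/-- The absolute bound for the box form over the whole box. -/
theorem lintegral_box_boxSet_le {R : ℝ} (hR : 0 ≤ R) {F₁ F₂ F₃ F₄ : ℝ → ℝ≥0∞}
    (h₁ : Measurable F₁) (h₂ : Measurable F₂) (h₃ : Measurable F₃) (h₄ : Measurable F₄) :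
    ∫⁻ v, ∫⁻ z, (boxSet R).indicator (fun _ => 1) z *
        (F₁ v * F₂ (v + shiftA z) * F₃ (v + shiftB z) * F₄ (v + shiftC z)) ≤
      ENNReal.ofReal (4 * R ^ 2) * ((∫⁻ u, F₁ u ^ 2) ^ (1 / 2 : ℝ) *
        (∫⁻ u, F₂ u ^ 2) ^ (1 / 2 : ℝ) *
        (∫⁻ u, F₃ u ^ 2) ^ (1 / 2 : ℝ) * (∫⁻ u, F₄ u ^ 2) ^ (1 / 2 : ℝ)) := by
  refine lintegral_box_le (w := (squareSet R).indicator fun _ => 1)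
    (measurable_const.indicator (isClosed_boxSet R).measurableSet)
    (measurable_const.indicator (measurableSet_squareSet R)) (fun c => ?_) (fun z => ?_)
    (fun z => ?_) h₁ h₂ h₃ h₄
  · simpa using lintegral_squareSet_le R hR c 1
  · by_cases hz : z ∈ boxSet R
    · rw [Set.indicator_of_mem (show _ ∈ squareSet R from ⟨hz.1, hz.2.2.2⟩)]
      exact Set.indicator_le_self _ _ _
    · simp [hz]
  · by_cases hz : z ∈ boxSet R
    · rw [Set.indicator_of_mem (show _ ∈ squareSet R from ⟨hz.2.1, hz.2.2.1⟩)]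
      exact Set.indicator_le_self _ _ _
    · simp [hz]

/-- The absolute bound for the box form near the degenerate set. -/
theorem lintegral_box_degenerate_le {R ρ : ℝ} (hR : 0 ≤ R) (hρ : 0 < ρ) (hρ1 : ρ ≤ 1)
    {W : ℝ × ℝ × ℝ → ℝ≥0∞} (hWm : Measurable W) (hWs : ∀ z ∉ boxSet R, W z = 0)
    (hW1 : ∀ z, W z ≤ 1)
    (hW : ∀ z : ℝ × ℝ × ℝ, ρ ≤ |z.1| → ρ ≤ |z.2.2| → ρ ≤ |4 * z.2.1 + 2 * z.1 + 2 * z.2.2 - 1| →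
      W z ≤ ENNReal.ofReal (ρ ^ 2))
    {F₁ F₂ F₃ F₄ : ℝ → ℝ≥0∞}
    (h₁ : Measurable F₁) (h₂ : Measurable F₂) (h₃ : Measurable F₃) (h₄ : Measurable F₄) :
    ∫⁻ v, ∫⁻ z, W z *
        (F₁ v * F₂ (v + shiftA z) * F₃ (v + shiftB z) * F₄ (v + shiftC z)) ≤
      ENNReal.ofReal ((4 * R ^ 2 + 18 * R) * √ρ) * ((∫⁻ u, F₁ u ^ 2) ^ (1 / 2 : ℝ) *
        (∫⁻ u, F₂ u ^ 2) ^ (1 / 2 : ℝ) *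
        (∫⁻ u, F₃ u ^ 2) ^ (1 / 2 : ℝ) * (∫⁻ u, F₄ u ^ 2) ^ (1 / 2 : ℝ)) := by
  -- In both coordinate systems `(p, q, l)` the forms `l`, `q - p - l`, `2(p + q) - 1` equal `l`, `±
  -- k`, `4t + 2k + 2l - 1`, so a single weight dominates `W` in both.
  have key : ∀ (z y : ℝ × ℝ × ℝ), y ∈ squareSet R → |y.2.2| = |z.2.2| →
      |y.2.1 - y.1 - y.2.2| = |z.1| →
      |2 * (y.1 + y.2.1) - 1| = |4 * z.2.1 + 2 * z.1 + 2 * z.2.2 - 1| →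
      W z ≤ degenerateWeight R ρ y := by
    intro z y hy e1 e2 e3
    unfold degenerateWeight
    by_cases hd : y ∈ degenerateSet ρ
    · rw [Set.indicator_of_mem (show y ∈ squareSet R ∩ degenerateSet ρ from ⟨hy, hd⟩)]
      exact (hW1 z).trans le_add_self
    · rw [Set.indicator_of_mem hy]
      have hd' : ¬ (|y.2.2| < ρ ∨ |y.2.1 - y.1 - y.2.2| < ρ ∨ |2 * (y.1 + y.2.1) - 1| < ρ) := hd
      rw [e1, e2, e3] at hd'
      push Not at hd'
      exact (hW z hd'.2.1 hd'.1 hd'.2.2).trans le_self_add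
  refine lintegral_box_le hWm (measurable_degenerateWeight R ρ)
    (fun c => lintegral_degenerateWeight_le hR hρ hρ1 c) (fun z => ?_) (fun z => ?_) h₁ h₂ h₃ h₄
  · by_cases hz : z ∈ boxSet R
    · exact key z _ ⟨hz.1, hz.2.2.2⟩ rfl (by ring_nf) (by ring_nf)
    · simp [hWs z hz]
  · by_cases hz : z ∈ boxSet R
    · exact key z _ ⟨hz.2.1, hz.2.2.1⟩ rfl (by rw [← abs_neg]; ring_nf) (by ring_nf)
    · simp [hWs z hz]

end Weights

/-! ### The vector field for the integration by parts. -/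

section Parts

open ComplexConjugate

/-- The polynomial vector field along which `shiftA` and `shiftB` are constant. -/
def levelField (z : ℝ × ℝ × ℝ) : ℝ × ℝ × ℝ :=
  (-z.1 * (2 * z.2.1 + 2 * z.2.2 - 1), (z.2.1 + z.1) * (2 * z.2.1 + 2 * z.2.2 - 1),
    -2 * z.2.2 * (z.2.1 + z.1))

/-- The derivative of `shiftC` along `levelField`. -/
def jacobian (z : ℝ × ℝ × ℝ) : ℝ := -2 * z.1 * z.2.2 * (4 * z.2.1 + 2 * z.1 + 2 * z.2.2 - 1)

/-- A smooth substitute for `s ↦ 1 / s`. -/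
noncomputable def regInv (δ s : ℝ) : ℝ := s / (s ^ 2 + δ ^ 2)

/-- The field is `-½ ∇A × ∇B`, hence annihilates `A` and `B`, and its derivative of `C` is `-½
det(∇A, ∇B, ∇C)`. The shifts need not be constant along the straight line; only the derivative at `s
= 0` matters. -/
theorem hasDerivAt_shift_line (z : ℝ × ℝ × ℝ) :
    HasDerivAt (fun s : ℝ => shiftA (z + s • levelField z)) 0 0 ∧
    HasDerivAt (fun s : ℝ => shiftB (z + s • levelField z)) 0 0 ∧
    HasDerivAt (fun s : ℝ => shiftC (z + s • levelField z)) (jacobian z) 0 := by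
  obtain ⟨k, t, l⟩ := z
  set V := levelField (k, t, l) with hV
  have lin : ∀ x y : ℝ, HasDerivAt (fun s : ℝ => x + s * y) y 0 := fun x y => by
    simpa using ((hasDerivAt_id (0 : ℝ)).mul_const y).const_add x
  have hk := lin k V.1
  have ht := lin t V.2.1
  have hl := lin l V.2.2
  refine ⟨?_, ?_, ?_⟩
  · have h := ((ht.add hk).pow 2).sub (ht.pow 2)
    refine (h.congr_deriv ?_).congr_of_eventuallyEq (Filter.Eventually.of_forall fun s => ?_)
    · simp [hV, levelField]
      ring
    · simp [shiftA]
  · have h := (((ht.add hl).pow 2).sub hl).sub (ht.pow 2)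
    refine (h.congr_deriv ?_).congr_of_eventuallyEq (Filter.Eventually.of_forall fun s => ?_)
    · simp [hV, levelField]
      ring
    · simp [shiftB]
  · have h := ((((ht.add hk).add hl).pow 2).sub hl).sub (ht.pow 2)
    refine (h.congr_deriv ?_).congr_of_eventuallyEq (Filter.Eventually.of_forall fun s => ?_)
    · simp [hV, levelField, jacobian]
      ring
    · simp [shiftC]

/-- The derivative along `levelField` only sees the last factor. -/
theorem fderiv_levelField {f g : ℝ → ℂ} (hf : ContDiff ℝ 1 f) (hg : ∀ x, HasDerivAt g (f x) x)
    (v : ℝ) (z : ℝ × ℝ × ℝ)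
    (hd : DifferentiableAt ℝ (fun z => conj (f (v + shiftA z)) * conj (f (v + shiftB z)) *
      g (v + shiftC z)) z) :
    fderiv ℝ (fun z => conj (f (v + shiftA z)) * conj (f (v + shiftB z)) * g (v + shiftC z)) z
      (levelField z) = jacobian z • (conj (f (v + shiftA z)) * conj (f (v + shiftB z)) *
        f (v + shiftC z)) := by
  obtain ⟨hA, hB, hC⟩ := hasDerivAt_shift_line z
  have z0 : z + (0 : ℝ) • levelField z = z := by simp
  have hfd : ∀ x, HasDerivAt f (deriv f x) x := fun x =>
    (hf.differentiable (by norm_num) x).hasDerivAt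
  have hl : HasDerivAt (fun s : ℝ => z + s • levelField z) (levelField z) 0 := by
    simpa using ((hasDerivAt_id (0 : ℝ)).smul_const (levelField z)).const_add z
  have h1 := hd.hasFDerivAt.comp_hasDerivAt_of_eq (0 : ℝ) hl z0.symm
  have a1 := ((hfd (v + shiftA (z + (0 : ℝ) • levelField z))).scomp (0 : ℝ) (hA.const_add v)).star
  have b1 := ((hfd (v + shiftB (z + (0 : ℝ) • levelField z))).scomp (0 : ℝ) (hB.const_add v)).star
  have c1 := (hg (v + shiftC (z + (0 : ℝ) • levelField z))).scomp (0 : ℝ) (hC.const_add v)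
  have h2 := (a1.mul b1).mul c1
  -- The same one-variable derivative is computed by the chain rule and by the product rule; the two
  -- conjugated factors have derivative zero there.
  refine (h1.unique h2).trans ?_
  simp
  ring

/-- Everything follows from `1 - s * regInv δ s = δ² / (s² + δ²)`: the defect lies in `[0, 1]` and
is at most `δ² / s²` away from zero. -/
theorem regInv_bounds {δ : ℝ} (hδ : 0 < δ) (s : ℝ) :
    |regInv δ s| ≤ 1 / δ ∧ |deriv (regInv δ) s| ≤ 1 / δ ^ 2 ∧
      0 ≤ s * regInv δ s ∧ s * regInv δ s ≤ 1 ∧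
      (1 - s * regInv δ s) * s ^ 2 ≤ δ ^ 2 := by
  have hpos : 0 < s ^ 2 + δ ^ 2 := by positivity
  have hder : HasDerivAt (regInv δ) ((δ ^ 2 - s ^ 2) / (s ^ 2 + δ ^ 2) ^ 2) s := by
    have := (hasDerivAt_id s).div (((hasDerivAt_id s).pow 2).add_const (δ ^ 2)) hpos.ne'
    refine (this.congr_deriv ?_)
    simp
    ring
  have e : s * regInv δ s = s ^ 2 / (s ^ 2 + δ ^ 2) := by unfold regInv; ring
  have e' : 1 - s * regInv δ s = δ ^ 2 / (s ^ 2 + δ ^ 2) := by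
    rw [e]; field_simp; ring
  refine ⟨?_, ?_, ?_, ?_, ?_⟩
  · unfold regInv
    rw [abs_div, abs_of_pos hpos, div_le_div_iff₀ hpos hδ]
    nlinarith [sq_abs s, sq_nonneg (|s| - δ), abs_nonneg s]
  · rw [hder.deriv, abs_div, abs_of_pos (by positivity : 0 < (s ^ 2 + δ ^ 2) ^ 2),
      div_le_div_iff₀ (by positivity) (by positivity)]
    have h1 : |δ ^ 2 - s ^ 2| ≤ s ^ 2 + δ ^ 2 := by
      rw [abs_le]; constructor <;> nlinarith [sq_nonneg s, sq_nonneg δ]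
    calc |δ ^ 2 - s ^ 2| * δ ^ 2 ≤ (s ^ 2 + δ ^ 2) * (s ^ 2 + δ ^ 2) := by
          gcongr
          nlinarith [sq_nonneg s]
      _ = 1 * (s ^ 2 + δ ^ 2) ^ 2 := by ring
  · rw [e]; positivity
  · rw [e, div_le_one hpos]; nlinarith
  · rw [e', div_mul_eq_mul_div, div_le_iff₀ hpos]
    nlinarith [sq_nonneg s, sq_nonneg δ, mul_nonneg (sq_nonneg δ) (sq_nonneg δ)]

theorem contDiff_regInv {δ : ℝ} (hδ : 0 < δ) : ContDiff ℝ 1 (regInv δ) := by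
  unfold regInv
  exact contDiff_id.div (by fun_prop) fun s => by positivity

end Parts

/-! ### Integration by parts and the size of the divergence. -/

section PartsDensity

open ComplexConjugate

/-- The standard basis vectors of `ℝ × ℝ × ℝ`. -/
def basisVec : Fin 3 → ℝ × ℝ × ℝ := ![(1, 0, 0), (0, 1, 0), (0, 0, 1)]

/-- The components of `levelField`. -/
def levelComp (i : Fin 3) (z : ℝ × ℝ × ℝ) : ℝ :=
  (![(levelField z).1, (levelField z).2.1, (levelField z).2.2] : Fin 3 → ℝ) i

theorem levelField_eq_sum (z : ℝ × ℝ × ℝ) :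
    levelField z = ∑ i, levelComp i z • basisVec i := by
  simp [Fin.sum_univ_three, levelComp, basisVec]

theorem contDiff_levelComp (i : Fin 3) : ContDiff ℝ 1 (levelComp i) := by
  have h : ContDiff ℝ 1 levelField := by
    unfold levelField
    fun_prop
  fin_cases i
  · exact h.fst
  · exact h.snd.fst
  · exact h.snd.snd

theorem contDiff_jacobian : ContDiff ℝ 1 jacobian := by
  unfold jacobian
  fun_prop

/-- The divergence of the vector field `a · regInv δ (jacobian) · levelField`. -/
noncomputable def partsDensity (a : ℝ × ℝ × ℝ → ℝ) (δ : ℝ) (z : ℝ × ℝ × ℝ) : ℝ :=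
  ∑ i, fderiv ℝ (fun z => a z * levelComp i z * regInv δ (jacobian z)) z (basisVec i)

theorem contDiff_partsFactor {a : ℝ × ℝ × ℝ → ℝ} (ha : ContDiff ℝ 1 a) {δ : ℝ} (hδ : 0 < δ)
    (i : Fin 3) : ContDiff ℝ 1 (fun z => a z * levelComp i z * regInv δ (jacobian z)) :=
  (ha.mul (contDiff_levelComp i)).mul ((contDiff_regInv hδ).comp contDiff_jacobian)

theorem partsDensity_eq_zero {a : ℝ × ℝ × ℝ → ℝ} {δ : ℝ} {z : ℝ × ℝ × ℝ} (hz : z ∉ tsupport a) :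
    partsDensity a δ z = 0 := by
  unfold partsDensity
  refine Finset.sum_eq_zero fun i _ => ?_
  have : (fun z => a z * levelComp i z * regInv δ (jacobian z)) =ᶠ[nhds z] fun _ => 0 := by
    filter_upwards [notMem_tsupport_iff_eventuallyEq.1 hz] with y hy
    simp [hy]
  rw [this.fderiv_eq]
  simp

/-- The product rule writes the divergence as `regInv · u + regInv' · w` at the Jacobian, with `u`,
`w` continuous, compactly supported and independent of `δ`. The worst loss is `1 / δ²`, from the
derivative of `regInv`. -/
theorem exists_partsDensity_bound {a : ℝ × ℝ × ℝ → ℝ} (ha : ContDiff ℝ 1 a)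
    (has : HasCompactSupport a) :
    ∃ C : ℝ, 0 ≤ C ∧ ∀ δ : ℝ, 0 < δ → δ ≤ 1 → ∀ z, |partsDensity a δ z| ≤ C / δ ^ 2 := by
  let u : ℝ × ℝ × ℝ → ℝ := fun z =>
    ∑ i, fderiv ℝ (fun z => a z * levelComp i z) z (basisVec i)
  let w : ℝ × ℝ × ℝ → ℝ := fun z =>
    a z * ∑ i, levelComp i z * fderiv ℝ jacobian z (basisVec i)
  have hau : ∀ i, ContDiff ℝ 1 fun z => a z * levelComp i z := fun i =>
    ha.mul (contDiff_levelComp i)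
  have huc : Continuous u := continuous_finsetSum _ fun i _ =>
    ((hau i).continuous_fderiv (by norm_num)).clm_apply continuous_const
  have hwc : Continuous w := ha.continuous.mul (continuous_finsetSum _ fun i _ =>
    (contDiff_levelComp i).continuous.mul
      ((contDiff_jacobian.continuous_fderiv (by norm_num)).clm_apply continuous_const))
  have hus : HasCompactSupport u := by
    refine HasCompactSupport.intro has.isCompact fun z hz => Finset.sum_eq_zero fun i _ => ?_
    have : (fun z => a z * levelComp i z) =ᶠ[nhds z] fun _ => 0 := by
      filter_upwards [notMem_tsupport_iff_eventuallyEq.1 hz] with y hy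
      simp [hy]
    rw [this.fderiv_eq]
    simp
  have hws : HasCompactSupport w := has.mul_right
  obtain ⟨M₁, hM₁⟩ := huc.bounded_above_of_compact_support hus
  obtain ⟨M₂, hM₂⟩ := hwc.bounded_above_of_compact_support hws
  have hM₁0 : 0 ≤ M₁ := (norm_nonneg _).trans (hM₁ 0)
  have hM₂0 : 0 ≤ M₂ := (norm_nonneg _).trans (hM₂ 0)
  refine ⟨M₁ + M₂, by positivity, fun δ hδ hδ1 z => ?_⟩
  have hq : DifferentiableAt ℝ (regInv δ) (jacobian z) :=
    (contDiff_regInv hδ).differentiable (by norm_num) _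
  have hJ : DifferentiableAt ℝ jacobian z := contDiff_jacobian.differentiable (by norm_num) _
  have hqJ : HasFDerivAt (fun z => regInv δ (jacobian z))
      (deriv (regInv δ) (jacobian z) • fderiv ℝ jacobian z) z :=
    hq.hasDerivAt.comp_hasFDerivAt z hJ.hasFDerivAt
  have hsplit : partsDensity a δ z =
      regInv δ (jacobian z) * u z + deriv (regInv δ) (jacobian z) * w z := by
    unfold partsDensity
    simp only [u, w, Finset.mul_sum, ← Finset.sum_add_distrib]
    refine Finset.sum_congr rfl fun i _ => ?_
    have h1 := (((hau i).differentiable (by norm_num) z).hasFDerivAt).mul hqJ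
    have h2 : fderiv ℝ (fun z => a z * levelComp i z * regInv δ (jacobian z)) z = _ := h1.fderiv
    rw [h2]
    simp
    ring
  obtain ⟨b1, b2, -⟩ := regInv_bounds hδ (jacobian z)
  have hu : |u z| ≤ M₁ := hM₁ z
  have hw : |w z| ≤ M₂ := hM₂ z
  have h12 : 1 / δ ≤ 1 / δ ^ 2 := by
    apply one_div_le_one_div_of_le (by positivity)
    nlinarith
  calc |partsDensity a δ z|
      ≤ |regInv δ (jacobian z)| * |u z| + |deriv (regInv δ) (jacobian z)| * |w z| := by
        rw [hsplit, ← abs_mul, ← abs_mul]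
        exact abs_add_le _ _
    _ ≤ (1 / δ ^ 2) * M₁ + (1 / δ ^ 2) * M₂ := by
        gcongr
        exact b1.trans h12
    _ = (M₁ + M₂) / δ ^ 2 := by ring

/-- Integration by parts along `levelField`. -/
theorem integral_parts {a : ℝ × ℝ × ℝ → ℝ} (ha : ContDiff ℝ 1 a) (has : HasCompactSupport a)
    {δ : ℝ} (hδ : 0 < δ) {f g : ℝ → ℂ} (hf : ContDiff ℝ 1 f) (hg : ∀ x, HasDerivAt g (f x) x)
    (v : ℝ) :
    ∫ z, (a z * (jacobian z * regInv δ (jacobian z))) •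
        (conj (f (v + shiftA z)) * conj (f (v + shiftB z)) * f (v + shiftC z)) =
      -∫ z, partsDensity a δ z •
        (conj (f (v + shiftA z)) * conj (f (v + shiftB z)) * g (v + shiftC z)) := by
  have hgC : ContDiff ℝ 1 g := by
    rw [contDiff_one_iff_deriv]
    refine ⟨fun x => (hg x).differentiableAt, ?_⟩
    have : deriv g = f := funext fun x => (hg x).deriv
    rw [this]
    exact hf.continuous
  have cA : ContDiff ℝ 1 shiftA := by unfold shiftA; fun_prop
  have cB : ContDiff ℝ 1 shiftB := by unfold shiftB; fun_prop
  have cC : ContDiff ℝ 1 shiftC := by unfold shiftC; fun_prop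
  have cconj : ContDiff ℝ 1 (fun w : ℂ => conj w) := Complex.conjCLE.contDiff
  set E : ℝ × ℝ × ℝ → ℂ := fun z =>
    conj (f (v + shiftA z)) * conj (f (v + shiftB z)) * g (v + shiftC z) with hE
  have hEC : ContDiff ℝ 1 E :=
    ((cconj.comp (hf.comp (contDiff_const.add cA))).mul
      (cconj.comp (hf.comp (contDiff_const.add cB)))).mul (hgC.comp (contDiff_const.add cC))
  let β : Fin 3 → ℝ × ℝ × ℝ → ℝ := fun i z => a z * levelComp i z * regInv δ (jacobian z)
  have hβ : ∀ i, ContDiff ℝ 1 (β i) := fun i => contDiff_partsFactor ha hδ i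
  have hβs : ∀ i, HasCompactSupport (β i) := fun i => (has.mul_right).mul_right
  have hEd : ∀ i, Continuous fun z => fderiv ℝ E z (basisVec i) := fun i =>
    (hEC.continuous_fderiv (by norm_num)).clm_apply continuous_const
  have hβd : ∀ i, Continuous fun z => fderiv ℝ (β i) z (basisVec i) := fun i =>
    ((hβ i).continuous_fderiv (by norm_num)).clm_apply continuous_const
  have hβds : ∀ i, HasCompactSupport fun z => fderiv ℝ (β i) z (basisVec i) := fun i =>
    (hβs i).fderiv_apply ℝ _
  have i1 : ∀ i, Integrable fun z => fderiv ℝ (β i) z (basisVec i) • E z := fun i =>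
    ((hβd i).smul hEC.continuous).integrable_of_hasCompactSupport (hβds i).smul_right
  have i2 : ∀ i, Integrable fun z => β i z • fderiv ℝ E z (basisVec i) := fun i =>
    ((hβ i).continuous.smul (hEd i)).integrable_of_hasCompactSupport (hβs i).smul_right
  have i3 : ∀ i, Integrable fun z => β i z • E z := fun i =>
    ((hβ i).continuous.smul hEC.continuous).integrable_of_hasCompactSupport (hβs i).smul_right
  have : (volume : Measure (ℝ × ℝ)).IsAddHaarMeasure :=
    Measure.prod.instIsAddHaarMeasure volume volume
  have : (volume : Measure (ℝ × ℝ × ℝ)).IsAddHaarMeasure :=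
    Measure.prod.instIsAddHaarMeasure volume volume
  have parts : ∀ i, ∫ z, β i z • fderiv ℝ E z (basisVec i) =
      -∫ z, fderiv ℝ (β i) z (basisVec i) • E z := fun i =>
    integral_smul_fderiv_eq_neg_fderiv_smul_of_integrable (i1 i) (i2 i) (i3 i)
      (fun z _ => (hβ i).differentiable (by norm_num) z)
      (fun z _ => hEC.differentiable (by norm_num) z)
  -- Summed over coordinates, the partial derivatives give the derivative along `levelField`, which
  -- produces the factor `jacobian` and turns `g` into `f`.
  have left : ∀ z, (a z * (jacobian z * regInv δ (jacobian z))) •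
      (conj (f (v + shiftA z)) * conj (f (v + shiftB z)) * f (v + shiftC z)) =
      ∑ i, β i z • fderiv ℝ E z (basisVec i) := by
    intro z
    have h1 := fderiv_levelField hf hg v z (hEC.differentiable (by norm_num) z)
    have h2 : ∑ i, β i z • fderiv ℝ E z (basisVec i) =
        (a z * regInv δ (jacobian z)) • fderiv ℝ E z (levelField z) := by
      rw [levelField_eq_sum, map_sum, Finset.smul_sum]
      refine Finset.sum_congr rfl fun i _ => ?_
      rw [map_smul, smul_smul]
      congr 1
      simp only [β]
      ring
    rw [h2, h1, smul_smul]
    congr 1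
    ring
  have right : ∀ z, partsDensity a δ z • E z = ∑ i, fderiv ℝ (β i) z (basisVec i) • E z := by
    intro z
    unfold partsDensity
    rw [Finset.sum_smul]
  rw [integral_congr_ae (Filter.Eventually.of_forall left),
    integral_congr_ae (Filter.Eventually.of_forall right), integral_finsetSum _ fun i _ => i2 i,
    integral_finsetSum _ fun i _ => i1 i, ← Finset.sum_neg_distrib]
  exact Finset.sum_congr rfl fun i _ => parts i

end PartsDensity

/-! ### The box form of a derivative. -/

section BoxEstimate

open ComplexConjugate

/-- The `L²` norm as a lower integral. -/
noncomputable def l2norm (f : ℝ → ℂ) : ℝ≥0∞ := (∫⁻ u, ‖f u‖ₑ ^ 2) ^ (1 / 2 : ℝ)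

theorem exists_abs_bound_of_hasCompactSupport {χ : ℝ → ℝ} (hχ : HasCompactSupport χ) :
    ∃ R : ℝ, 0 ≤ R ∧ ∀ t, R < |t| → χ t = 0 := by
  obtain ⟨R, hR⟩ := hχ.isCompact.isBounded.subset_closedBall 0
  refine ⟨max R 0, le_max_right _ _, fun t ht => ?_⟩
  by_contra h
  have := hR (subset_tsupport _ h)
  rw [mem_closedBall_zero_iff, Real.norm_eq_abs] at this
  exact absurd (ht.trans_le this) (not_lt.2 (le_max_left _ _))

theorem boxCutoff_eq_zero {χ : ℝ → ℝ} {R : ℝ} (hR : ∀ t, R < |t| → χ t = 0) {z : ℝ × ℝ × ℝ}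
    (hz : z ∉ boxSet R) : boxCutoff χ z = 0 := by
  have hz' : ¬ (|z.2.1| ≤ R ∧ |z.2.1 + z.1| ≤ R ∧ |z.2.1 + z.2.2| ≤ R ∧
      |z.2.1 + z.1 + z.2.2| ≤ R) := hz
  unfold boxCutoff
  by_contra h
  refine hz' ⟨?_, ?_, ?_, ?_⟩ <;>
  · by_contra hlt
    exact h (by simp [hR _ (not_le.1 hlt)])

theorem tsupport_boxCutoff_subset {χ : ℝ → ℝ} {R : ℝ} (hR : ∀ t, R < |t| → χ t = 0) :
    tsupport (boxCutoff χ) ⊆ boxSet R :=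
  closure_minimal (fun _ hz => by_contra fun h => hz (boxCutoff_eq_zero hR h)) (isClosed_boxSet R)

theorem hasCompactSupport_boxCutoff {χ : ℝ → ℝ} {R : ℝ} (hR : ∀ t, R < |t| → χ t = 0) :
    HasCompactSupport (boxCutoff χ) := by
  refine HasCompactSupport.intro (K := Set.Icc (-(2 * R)) (2 * R) ×ˢ Set.Icc (-R) R ×ˢ
    Set.Icc (-(2 * R)) (2 * R)) (isCompact_Icc.prod (isCompact_Icc.prod isCompact_Icc))
    fun z hz => boxCutoff_eq_zero hR fun h => hz ?_
  obtain ⟨h1, h2, h3, h4⟩ := h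
  rw [abs_le] at h1 h2 h3
  exact ⟨⟨by linarith, by linarith⟩, ⟨h1.1, h1.2⟩, ⟨by linarith, by linarith⟩⟩

theorem contDiff_boxCutoff {χ : ℝ → ℝ} (hχ : ContDiff ℝ 1 χ) : ContDiff ℝ 1 (boxCutoff χ) := by
  unfold boxCutoff
  fun_prop

theorem boxCutoff_mem {χ : ℝ → ℝ} (h : ∀ t, 0 ≤ χ t ∧ χ t ≤ 1) (z : ℝ × ℝ × ℝ) :
    0 ≤ boxCutoff χ z ∧ boxCutoff χ z ≤ 1 := by
  unfold boxCutoff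
  have m : ∀ x y : ℝ, 0 ≤ x ∧ x ≤ 1 → 0 ≤ y ∧ y ≤ 1 → 0 ≤ x * y ∧ x * y ≤ 1 := fun x y hx hy =>
    ⟨mul_nonneg hx.1 hy.1, mul_le_one₀ hx.2 hy.1 hy.2⟩
  exact m _ _ (m _ _ (m _ _ (h _) (h _)) (h _)) (h _)

/-- The part of the box form near the degenerate set is small. -/
theorem lintegral_box_remainder_le {χ : ℝ → ℝ} (hχ : ContDiff ℝ 1 χ)
    (hχ01 : ∀ t, 0 ≤ χ t ∧ χ t ≤ 1) {R : ℝ} (hR0 : 0 ≤ R) (hR : ∀ t, R < |t| → χ t = 0) {ρ : ℝ}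
    (hρ : 0 < ρ) (hρ1 : ρ ≤ 1) {f : ℝ → ℂ} (hf : Continuous f) :
    ∫⁻ v, ∫⁻ z, ‖boxCutoff χ z * (1 - jacobian z * regInv (ρ ^ 4) (jacobian z))‖ₑ *
        (‖f v‖ₑ * ‖f (v + shiftA z)‖ₑ * ‖f (v + shiftB z)‖ₑ * ‖f (v + shiftC z)‖ₑ) ≤
      ENNReal.ofReal ((4 * R ^ 2 + 18 * R) * √ρ) * l2norm f ^ 4 := by
  have hδ : 0 < ρ ^ 4 := by positivity
  have hc : Continuous fun z => boxCutoff χ z *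
      (1 - jacobian z * regInv (ρ ^ 4) (jacobian z)) :=
    (contDiff_boxCutoff hχ).continuous.mul (continuous_const.sub (contDiff_jacobian.continuous.mul
      ((contDiff_regInv hδ).continuous.comp contDiff_jacobian.continuous)))
  have hfm : Measurable fun u => ‖f u‖ₑ := hf.enorm.measurable
  refine (lintegral_box_degenerate_le hR0 hρ hρ1 hc.enorm.measurable (fun z hz => ?_) (fun z => ?_)
    (fun z hk hl hS => ?_) hfm hfm hfm hfm).trans (le_of_eq ?_)
  · simp [boxCutoff_eq_zero hR hz]
  · obtain ⟨-, -, h3, h4, -⟩ := regInv_bounds hδ (jacobian z)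
    obtain ⟨a0, a1⟩ := boxCutoff_mem hχ01 z
    rw [Real.enorm_of_nonneg (mul_nonneg a0 (by linarith))]
    rw [ENNReal.ofReal_le_one]
    exact mul_le_one₀ a1 (by linarith) (by linarith)
  · obtain ⟨-, -, h3, h4, h5⟩ := regInv_bounds hδ (jacobian z)
    obtain ⟨a0, a1⟩ := boxCutoff_mem hχ01 z
    rw [Real.enorm_of_nonneg (mul_nonneg a0 (by linarith))]
    apply ENNReal.ofReal_le_ofReal
    -- All three linear factors are at least `ρ` here. With `δ = ρ⁴` the defect is then at most `δ²
    -- / ρ⁶ = ρ²`, the constant part of the degenerate weight.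
    have hJ : ρ ^ 3 ≤ |jacobian z| := by
      unfold jacobian
      rw [abs_mul, abs_mul, abs_mul]
      have h2 : |(-2 : ℝ)| = 2 := by norm_num
      rw [h2]
      calc ρ ^ 3 = 1 * ρ * ρ * ρ := by ring
        _ ≤ 2 * |z.1| * |z.2.2| * |4 * z.2.1 + 2 * z.1 + 2 * z.2.2 - 1| := by
          gcongr
          norm_num
    have hJ2 : ρ ^ 6 ≤ jacobian z ^ 2 := by
      rw [← sq_abs (jacobian z)]
      calc ρ ^ 6 = (ρ ^ 3) ^ 2 := by ring
        _ ≤ _ := by gcongr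
    set x := 1 - jacobian z * regInv (ρ ^ 4) (jacobian z) with hx
    have hx0 : 0 ≤ x := by linarith
    have h6 : x * ρ ^ 6 ≤ ρ ^ 2 * ρ ^ 6 := by
      calc x * ρ ^ 6 ≤ x * jacobian z ^ 2 := by gcongr
        _ ≤ (ρ ^ 4) ^ 2 := h5
        _ = ρ ^ 2 * ρ ^ 6 := by ring
    have h7 : x ≤ ρ ^ 2 := le_of_mul_le_mul_right h6 (by positivity)
    calc boxCutoff χ z * x ≤ 1 * x := by gcongr
      _ ≤ ρ ^ 2 := by linarith
  · unfold l2norm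
    ring

/-- The box form of a derivative `f = g'` is controlled by the size of `g`. -/
theorem exists_box_estimate {χ : ℝ → ℝ} (hχ : ContDiff ℝ 1 χ) (hχs : HasCompactSupport χ)
    (hχ01 : ∀ t, 0 ≤ χ t ∧ χ t ≤ 1) :
    ∃ C : ℝ, 0 ≤ C ∧ ∀ f g : ℝ → ℂ, ContDiff ℝ 1 f → HasCompactSupport f →
      (∀ x, HasDerivAt g (f x) x) → ∀ ρ : ℝ, 0 < ρ → ρ ≤ 1 →
      ‖∫ w : ℝ × ℝ × ℝ × ℝ, (boxCutoff χ w.2 : ℂ) * (f w.1 * conj (f (w.1 + shiftA w.2)) *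
        conj (f (w.1 + shiftB w.2)) * f (w.1 + shiftC w.2))‖ₑ ≤
      ENNReal.ofReal (C * √ρ) * l2norm f ^ 4 +
        ENNReal.ofReal (C / ρ ^ 8) * (l2norm f ^ 3 * l2norm g) := by
  obtain ⟨R, hR0, hR⟩ := exists_abs_bound_of_hasCompactSupport hχs
  set a := boxCutoff χ with ha
  have haC : ContDiff ℝ 1 a := contDiff_boxCutoff hχ
  have has : HasCompactSupport a := hasCompactSupport_boxCutoff hR
  obtain ⟨C₁, hC₁0, hC₁⟩ := exists_partsDensity_bound haC has
  refine ⟨max (4 * R ^ 2 + 18 * R) (C₁ * (4 * R ^ 2)), le_max_of_le_left (by positivity), ?_⟩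
  intro f g hf hfs hg ρ hρ hρ1
  have hδ : 0 < ρ ^ 4 := by positivity
  have hδ1 : ρ ^ 4 ≤ 1 := pow_le_one₀ hρ.le hρ1
  have hgc : Continuous g := continuous_iff_continuousAt.2 fun x => (hg x).continuousAt
  -- The partition `1 = (1 - ω) + ω`: the first part is estimated in absolute value, the second is
  -- integrated by parts.
  let ω : ℝ × ℝ × ℝ → ℝ := fun z => jacobian z * regInv (ρ ^ 4) (jacobian z)
  have hωc : Continuous ω := contDiff_jacobian.continuous.mul
      ((contDiff_regInv hδ).continuous.comp contDiff_jacobian.continuous)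
  let Ψ : ℝ → ℝ × ℝ × ℝ → ℂ := fun v z =>
    conj (f (v + shiftA z)) * conj (f (v + shiftB z)) * f (v + shiftC z)
  have cA := continuous_shiftA
  have cB := continuous_shiftB
  have cC := continuous_shiftC
  have hfc := hf.continuous
  have cc := Complex.continuous_conj
  have hΨc : Continuous fun w : ℝ × ℝ × ℝ × ℝ => Ψ w.1 w.2 := by
    have e1 : Continuous fun w : ℝ × ℝ × ℝ × ℝ => f (w.1 + shiftA w.2) := by fun_prop
    have e2 : Continuous fun w : ℝ × ℝ × ℝ × ℝ => f (w.1 + shiftB w.2) := by fun_prop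
    have e3 : Continuous fun w : ℝ × ℝ × ℝ × ℝ => f (w.1 + shiftC w.2) := by fun_prop
    exact ((cc.comp e1).mul (cc.comp e2)).mul e3
  have hint : ∀ b : ℝ × ℝ × ℝ → ℝ, Continuous b → Integrable (fun w : ℝ × ℝ × ℝ × ℝ =>
      f w.1 * ((a w.2 * b w.2) • Ψ w.1 w.2)) (volume.prod volume) := by
    intro b hb
    have hcont : Continuous (fun w : ℝ × ℝ × ℝ × ℝ => f w.1 * ((a w.2 * b w.2) • Ψ w.1 w.2)) :=
      (hfc.comp continuous_fst).mul
        (((haC.continuous.comp continuous_snd).mul (hb.comp continuous_snd)).smul hΨc)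
    refine hcont.integrable_of_hasCompactSupport
      (HasCompactSupport.intro (hfs.isCompact.prod has.isCompact) fun w hw => ?_)
    by_cases h1 : w.1 ∈ tsupport f
    · have h2 : w.2 ∉ tsupport a := fun h => hw ⟨h1, h⟩
      simp [image_eq_zero_of_notMem_tsupport h2]
    · simp [image_eq_zero_of_notMem_tsupport h1]
  have hsplit : ∫ w : ℝ × ℝ × ℝ × ℝ, (a w.2 : ℂ) * (f w.1 * conj (f (w.1 + shiftA w.2)) *
        conj (f (w.1 + shiftB w.2)) * f (w.1 + shiftC w.2)) =
      (∫ v, ∫ z, f v * ((a z * (1 - ω z)) • Ψ v z)) + ∫ v, f v * ∫ z, (a z * ω z) • Ψ v z := by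
    have e1 : ∫ v, ∫ z, f v * ((a z * (1 - ω z)) • Ψ v z) =
        ∫ w : ℝ × ℝ × ℝ × ℝ, f w.1 * ((a w.2 * (1 - ω w.2)) • Ψ w.1 w.2) ∂(volume.prod volume) :=
      (integral_prod _ (hint (fun z => 1 - ω z) (continuous_const.sub hωc))).symm
    have e2 : ∫ v, f v * ∫ z, (a z * ω z) • Ψ v z =
        ∫ w : ℝ × ℝ × ℝ × ℝ, f w.1 * ((a w.2 * ω w.2) • Ψ w.1 w.2) ∂(volume.prod volume) := by
      rw [integral_prod _ (hint ω hωc)]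
      refine integral_congr_ae (Filter.Eventually.of_forall fun v => ?_)
      exact (integral_const_mul (f v) _).symm
    rw [e1, e2, ← integral_add (hint (fun z => 1 - ω z) (continuous_const.sub hωc)) (hint ω hωc)]
    refine integral_congr_ae (Filter.Eventually.of_forall fun w => ?_)
    simp only [Ψ, Complex.real_smul]
    push_cast
    ring
  have hparts : ∫ v, f v * ∫ z, (a z * ω z) • Ψ v z =
      -∫ v, ∫ z, f v * (partsDensity a (ρ ^ 4) z •
        (conj (f (v + shiftA z)) * conj (f (v + shiftB z)) * g (v + shiftC z))) := by
    rw [← integral_neg]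
    refine integral_congr_ae (Filter.Eventually.of_forall fun v => ?_)
    have h1 := integral_parts haC has hδ hf hg v
    have h2 : ∫ z, (a z * ω z) • Ψ v z = _ := h1
    simp only [h2, mul_neg]
    rw [← integral_const_mul]
  have iter : ∀ G : ℝ → ℝ × ℝ × ℝ → ℂ, ‖∫ v, ∫ z, G v z‖ₑ ≤ ∫⁻ v, ∫⁻ z, ‖G v z‖ₑ := fun G =>
    (enorm_integral_le_lintegral_enorm _).trans
      (lintegral_mono fun v => enorm_integral_le_lintegral_enorm _)
  have hconj : ∀ w : ℂ, ‖conj w‖ₑ = ‖w‖ₑ := fun w => by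
    rw [← ofReal_norm, ← ofReal_norm, RCLike.norm_conj]
  have first : ‖∫ v, ∫ z, f v * ((a z * (1 - ω z)) • Ψ v z)‖ₑ ≤
      ENNReal.ofReal ((4 * R ^ 2 + 18 * R) * √ρ) * l2norm f ^ 4 := by
    refine (iter _).trans (le_trans (le_of_eq ?_)
      (lintegral_box_remainder_le hχ hχ01 hR0 hR hρ hρ1 hfc))
    refine lintegral_congr fun v => lintegral_congr fun z => ?_
    simp only [Ψ, enorm_mul, enorm_smul, hconj, ω, ha]
    ring
  have second : ‖∫ v, f v * ∫ z, (a z * ω z) • Ψ v z‖ₑ ≤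
      ENNReal.ofReal (C₁ * (4 * R ^ 2) / ρ ^ 8) * (l2norm f ^ 3 * l2norm g) := by
    rw [hparts, enorm_neg]
    have hfm : Measurable fun u => ‖f u‖ₑ := hfc.enorm.measurable
    have hgm : Measurable fun u => ‖g u‖ₑ := hgc.enorm.measurable
    have mA := cA.measurable
    have mB := cB.measurable
    have mC := cC.measurable
    have hbm : Measurable ((boxSet R).indicator (fun _ => (1 : ℝ≥0∞))) :=
      measurable_const.indicator (isClosed_boxSet R).measurableSet
    calc _ ≤ ∫⁻ v, ∫⁻ z, ‖f v * (partsDensity a (ρ ^ 4) z •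
            (conj (f (v + shiftA z)) * conj (f (v + shiftB z)) * g (v + shiftC z)))‖ₑ := iter _
      _ ≤ ∫⁻ v, ∫⁻ z, ENNReal.ofReal (C₁ / ρ ^ 8) * ((boxSet R).indicator (fun _ => 1) z *
            (‖f v‖ₑ * ‖f (v + shiftA z)‖ₑ * ‖f (v + shiftB z)‖ₑ * ‖g (v + shiftC z)‖ₑ)) := by
          refine lintegral_mono fun v => lintegral_mono fun z => ?_
          -- The divergence bound `C₁ / δ²` with `δ = ρ⁴`, restricted to the box because the
          -- divergence vanishes off the support of the cutoff.
          have hγ : ‖partsDensity a (ρ ^ 4) z‖ₑ ≤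
              ENNReal.ofReal (C₁ / ρ ^ 8) * (boxSet R).indicator (fun _ => 1) z := by
            by_cases hz : z ∈ boxSet R
            · rw [Set.indicator_of_mem hz, mul_one, ← ofReal_norm]
              apply ENNReal.ofReal_le_ofReal
              refine (hC₁ _ hδ hδ1 z).trans (le_of_eq ?_)
              ring
            · have : z ∉ tsupport a := fun h => hz (tsupport_boxCutoff_subset hR h)
              simp [partsDensity_eq_zero this]
          simp only [enorm_mul, enorm_smul, hconj]
          calc _ = ‖partsDensity a (ρ ^ 4) z‖ₑ * (‖f v‖ₑ * ‖f (v + shiftA z)‖ₑ *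
                ‖f (v + shiftB z)‖ₑ * ‖g (v + shiftC z)‖ₑ) := by ring
            _ ≤ _ := by
              rw [← mul_assoc (ENNReal.ofReal _)]
              exact mul_le_mul' hγ le_rfl
      _ = ENNReal.ofReal (C₁ / ρ ^ 8) * ∫⁻ v, ∫⁻ z, (boxSet R).indicator (fun _ => 1) z *
            (‖f v‖ₑ * ‖f (v + shiftA z)‖ₑ * ‖f (v + shiftB z)‖ₑ * ‖g (v + shiftC z)‖ₑ) := by
          have hm : Measurable fun w : ℝ × ℝ × ℝ × ℝ => (boxSet R).indicator (fun _ => 1) w.2 *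
              (‖f w.1‖ₑ * ‖f (w.1 + shiftA w.2)‖ₑ * ‖f (w.1 + shiftB w.2)‖ₑ *
                ‖g (w.1 + shiftC w.2)‖ₑ) :=
            (hbm.comp measurable_snd).mul ((((hfm.comp measurable_fst).mul
              (hfm.comp (measurable_fst.add (mA.comp measurable_snd)))).mul
              (hfm.comp (measurable_fst.add (mB.comp measurable_snd)))).mul
              (hgm.comp (measurable_fst.add (mC.comp measurable_snd))))
          rw [← lintegral_const_mul _ hm.lintegral_prod_right']
          refine lintegral_congr fun v => ?_
          exact lintegral_const_mul _ (hm.comp (measurable_prodMk_left (x := v)))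
      _ ≤ ENNReal.ofReal (C₁ / ρ ^ 8) * (ENNReal.ofReal (4 * R ^ 2) *
            (l2norm f * l2norm f * l2norm f * l2norm g)) := by
          gcongr
          exact lintegral_box_boxSet_le hR0 hfm hfm hfm hgm
      _ = _ := by
          rw [← mul_assoc, ← ENNReal.ofReal_mul (by positivity)]
          congr 1
          · congr 1
            ring
          · ring
  rw [hsplit]
  refine (enorm_add_le _ _).trans (add_le_add (first.trans ?_) (second.trans ?_))
  · gcongr
    exact le_max_left _ _
  · gcongr
    exact le_max_right _ _

end BoxEstimate

/-! ### Gain of a power of `h` on differences by `h`. -/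

section Translation

open ComplexConjugate

theorem l2norm_eq_eLpNorm (f : ℝ → ℂ) : l2norm f = eLpNorm f 2 volume := by
  rw [eLpNorm_eq_lintegral_rpow_enorm_toReal (by norm_num) (by norm_num)]
  simp [l2norm]

theorem integral_norm_sq_eq {f : ℝ → ℂ} (hf : MemLp f 2 volume) :
    ∫ x, ‖f x‖ ^ 2 = (eLpNorm f 2 volume).toReal ^ 2 := by
  have h := hf.eLpNorm_eq_integral_rpow_norm (by norm_num) (by norm_num)
  have h0 : 0 ≤ ∫ x, ‖f x‖ ^ 2 := by positivity
  rw [h, ENNReal.toReal_ofReal (by positivity)]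
  simp only [ENNReal.toReal_ofNat, Real.rpow_two]
  rw [← Real.rpow_natCast, ← Real.rpow_mul h0]
  norm_num

theorem eLpNorm_sub_translate_le {F : ℝ → ℂ} (hF : Continuous F) (h : ℝ) :
    eLpNorm (fun x => F (x + h) - F x) 2 volume ≤ 2 * eLpNorm F 2 volume := by
  have e : eLpNorm (fun x => F (x + h)) 2 volume = eLpNorm F 2 volume :=
    eLpNorm_comp_measurePreserving hF.aestronglyMeasurable (measurePreserving_add_right volume h)
  have := eLpNorm_sub_le (μ := volume) (p := 2) (f := fun x => F (x + h)) (g := F)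
    (hF.comp (continuous_add_const h)).aestronglyMeasurable hF.aestronglyMeasurable (by norm_num)
  rw [e, ← two_mul] at this
  exact this

/-- The `L²` norm of a moving integral over an interval of length `h`. -/
theorem eLpNorm_moving_integral_le {F : ℝ → ℂ} (hF : Continuous F) {h : ℝ} (hh : 0 ≤ h) :
    eLpNorm (fun x => ∫ s in (0 : ℝ)..h, F (x + s)) 2 volume ≤
      ENNReal.ofReal h * eLpNorm F 2 volume := by
  rw [← l2norm_eq_eLpNorm, ← l2norm_eq_eLpNorm]
  have hFm : Measurable fun u => ‖F u‖ₑ := hF.enorm.measurable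
  -- Cauchy-Schwarz in `s` gives one factor `h`; integrating the remaining mean in `x` gives the
  -- second.
  have pt : ∀ x, ‖∫ s in (0 : ℝ)..h, F (x + s)‖ₑ ^ 2 ≤
      ENNReal.ofReal h * ∫⁻ s in Set.Ioc 0 h, ‖F (x + s)‖ₑ ^ 2 := by
    intro x
    have h1 : ‖∫ s in (0 : ℝ)..h, F (x + s)‖ₑ ≤ ∫⁻ s in Set.Ioc 0 h, ‖F (x + s)‖ₑ := by
      rw [intervalIntegral.integral_of_le hh]
      exact enorm_integral_le_lintegral_enorm _
    have h2 := ENNReal.lintegral_mul_le_Lp_mul_Lq (volume.restrict (Set.Ioc 0 h))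
      Real.HolderConjugate.two_two (f := fun _ => 1) (g := fun s => ‖F (x + s)‖ₑ)
      aemeasurable_const (hFm.comp (measurable_const_add x)).aemeasurable
    have h3 : ∫⁻ s in Set.Ioc 0 h, ‖F (x + s)‖ₑ ≤ (ENNReal.ofReal h) ^ (1 / 2 : ℝ) *
        (∫⁻ s in Set.Ioc 0 h, ‖F (x + s)‖ₑ ^ 2) ^ (1 / 2 : ℝ) := by
      simpa using h2
    have hsq : ∀ y : ℝ≥0∞, (y ^ (1 / 2 : ℝ)) ^ 2 = y := fun y => by
      rw [← ENNReal.rpow_natCast, ← ENNReal.rpow_mul]; norm_num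
    calc _ ≤ ((ENNReal.ofReal h) ^ (1 / 2 : ℝ) *
        (∫⁻ s in Set.Ioc 0 h, ‖F (x + s)‖ₑ ^ 2) ^ (1 / 2 : ℝ)) ^ 2 := by
          gcongr
          exact h1.trans h3
      _ = _ := by rw [mul_pow, hsq, hsq]
  have hjm : Measurable fun p : ℝ × ℝ => ‖F (p.1 + p.2)‖ₑ ^ 2 :=
    (hFm.comp (measurable_fst.add measurable_snd)).pow_const 2
  have total : ∫⁻ x, ‖∫ s in (0 : ℝ)..h, F (x + s)‖ₑ ^ 2 ≤
      ENNReal.ofReal h ^ 2 * ∫⁻ u, ‖F u‖ₑ ^ 2 := by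
    calc _ ≤ ∫⁻ x, ENNReal.ofReal h * ∫⁻ s in Set.Ioc 0 h, ‖F (x + s)‖ₑ ^ 2 := lintegral_mono pt
      _ = ENNReal.ofReal h * ∫⁻ x, ∫⁻ s in Set.Ioc 0 h, ‖F (x + s)‖ₑ ^ 2 :=
          lintegral_const_mul _ hjm.lintegral_prod_right'
      _ = ENNReal.ofReal h * ∫⁻ s in Set.Ioc 0 h, ∫⁻ x, ‖F (x + s)‖ₑ ^ 2 := by
          rw [lintegral_lintegral_swap hjm.aemeasurable]
      _ = ENNReal.ofReal h * ∫⁻ s in Set.Ioc 0 h, ∫⁻ x, ‖F x‖ₑ ^ 2 := by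
          congr 1
          refine lintegral_congr fun s => ?_
          exact lintegral_add_right_eq_self (fun x => ‖F x‖ₑ ^ 2) s
      _ = _ := by
          rw [setLIntegral_const, Real.volume_Ioc, sub_zero]
          ring
  unfold l2norm
  calc _ ≤ (ENNReal.ofReal h ^ 2 * ∫⁻ u, ‖F u‖ₑ ^ 2) ^ (1 / 2 : ℝ) := by gcongr
    _ = _ := by
      rw [ENNReal.mul_rpow_of_nonneg _ _ (by norm_num), ← ENNReal.rpow_natCast,
        ← ENNReal.rpow_mul]
      norm_num

/-- Provides the primitive of `F(· + h) - F` whose `L²` norm is `O(h)`. -/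
theorem hasDerivAt_moving_integral {F : ℝ → ℂ} (hF : Continuous F) (h x : ℝ) :
    HasDerivAt (fun x => ∫ s in (0 : ℝ)..h, F (x + s)) (F (x + h) - F x) x := by
  have e : (fun x => ∫ s in (0 : ℝ)..h, F (x + s)) =
      fun x => (∫ s in (0 : ℝ)..(x + h), F s) - ∫ s in (0 : ℝ)..x, F s := by
    ext y
    rw [intervalIntegral.integral_comp_add_left, add_zero,
      intervalIntegral.integral_interval_sub_left (hF.intervalIntegrable _ _)
        (hF.intervalIntegrable _ _)]
  rw [e]
  have d : ∀ y, HasDerivAt (fun x => ∫ s in (0 : ℝ)..x, F s) (F y) y := fun y =>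
    (hF.integral_hasStrictDerivAt 0 y).hasDerivAt
  exact ((d (x + h)).comp_add_const x h).sub (d x)

/-- The trilinear form gains a power of `h` on differences `F(· + h) - F`. -/
theorem exists_translation_bound {χ : ℝ → ℝ} (hχ : ContDiff ℝ 1 χ) (hχs : HasCompactSupport χ)
    (hχ01 : ∀ t, 0 ≤ χ t ∧ χ t ≤ 1) :
    ∃ C : ℝ, 0 ≤ C ∧ ∀ f₀ f₁ F : ℝ → ℂ, MemLp f₀ 2 volume → MemLp f₁ 2 volume →
      ContDiff ℝ 1 F → HasCompactSupport F → ∀ h : ℝ, 0 < h → h ≤ 1 →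
      ‖∫ x, f₀ x * ∫ y, f₁ y * parabolaKernel χ (fun x => F (x + h) - F x) x y‖ ≤
        C * h ^ (1 / 128 : ℝ) * (eLpNorm f₀ 2 volume).toReal * (eLpNorm f₁ 2 volume).toReal *
          (eLpNorm F 2 volume).toReal := by
  obtain ⟨C, hC0, hC⟩ := exists_box_estimate hχ hχs hχ01
  refine ⟨24 * C + 1, by positivity, ?_⟩
  intro f₀ f₁ F h₀ h₁ hF hFs h hh hh1
  set f : ℝ → ℂ := fun x => F (x + h) - F x with hf
  set g : ℝ → ℂ := fun x => ∫ s in (0 : ℝ)..h, F (x + s) with hg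
  have hfC : ContDiff ℝ 1 f := by fun_prop
  have hfs : HasCompactSupport f :=
    (hFs.comp_homeomorph (Homeomorph.addRight h)).sub hFs
  have hcs := box_cauchy_schwarz (continuous_parabolaKernel hχ.continuous hfC.continuous)
    (hasCompactSupport_parabolaKernel hχs hfs) h₀ h₁
  have hFL : MemLp F 2 volume := hF.continuous.memLp_of_hasCompactSupport hFs
  set n₀ := (eLpNorm f₀ 2 volume).toReal with hn₀
  set n₁ := (eLpNorm f₁ 2 volume).toReal with hn₁
  set N := (eLpNorm F 2 volume).toReal with hN
  have hNof : eLpNorm F 2 volume = ENNReal.ofReal N := (ENNReal.ofReal_toReal hFL.2.ne).symm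
  have hN0 : 0 ≤ N := ENNReal.toReal_nonneg
  rw [integral_norm_sq_eq h₀, integral_norm_sq_eq h₁] at hcs
  set Q := ∫ p : ℝ × ℝ, ‖∫ x, parabolaKernel χ f x p.1 * conj (parabolaKernel χ f x p.2)‖ ^ 2
    with hQ
  have hQ0 : 0 ≤ Q := by positivity
  have hQeq := box_integral_eq hχ.continuous hχs hfC.continuous hfs
  rw [← hQ] at hQeq
  -- With this width the two terms are of order `√ρ = h^(1/32)` and `h / ρ⁸ = h^(1/2)`. The fourth
  -- root from the double Cauchy-Schwarz turns `h^(1/32)` into `h^(1/128)`.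
  set ρ := h ^ (1 / 16 : ℝ) with hρ
  have hρ0 : 0 < ρ := by positivity
  have hρ1 : ρ ≤ 1 := Real.rpow_le_one hh.le hh1 (by norm_num)
  have hbox := hC f g hfC hfs (fun x => hasDerivAt_moving_integral hF.continuous h x) ρ hρ0 hρ1
  rw [← hQeq, l2norm_eq_eLpNorm, l2norm_eq_eLpNorm, ← ofReal_norm, Complex.norm_real,
    Real.norm_of_nonneg hQ0] at hbox
  have hf2 : eLpNorm f 2 volume ≤ ENNReal.ofReal (2 * N) := by
    refine (eLpNorm_sub_translate_le hF.continuous h).trans (le_of_eq ?_)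
    rw [hNof, ENNReal.ofReal_mul (by norm_num)]
    simp
  have hg2 : eLpNorm g 2 volume ≤ ENNReal.ofReal (h * N) := by
    refine (eLpNorm_moving_integral_le hF.continuous hh.le).trans (le_of_eq ?_)
    rw [hNof, ENNReal.ofReal_mul hh.le]
  have hQle : Q ≤ C * √ρ * (2 * N) ^ 4 + C / ρ ^ 8 * ((2 * N) ^ 3 * (h * N)) := by
    rw [← ENNReal.ofReal_le_ofReal_iff (by positivity)]
    refine hbox.trans ?_
    rw [ENNReal.ofReal_add (by positivity) (by positivity),
      ENNReal.ofReal_mul (p := C * √ρ) (by positivity),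
      ENNReal.ofReal_mul (p := C / ρ ^ 8) (by positivity),
      ENNReal.ofReal_mul (p := (2 * N) ^ 3) (by positivity), ENNReal.ofReal_pow (by positivity),
      ENNReal.ofReal_pow (by positivity)]
    gcongr
  have e1 : √ρ = h ^ (1 / 32 : ℝ) := by
    rw [Real.sqrt_eq_rpow, hρ, ← Real.rpow_mul hh.le]
    norm_num
  have e2 : h / ρ ^ 8 ≤ h ^ (1 / 32 : ℝ) := by
    have : ρ ^ 8 = h ^ (1 / 2 : ℝ) := by
      rw [hρ, ← Real.rpow_natCast, ← Real.rpow_mul hh.le]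
      norm_num
    rw [this]
    nth_rewrite 1 [← Real.rpow_one h]
    rw [← Real.rpow_sub hh]
    exact Real.rpow_le_rpow_of_exponent_ge hh hh1 (by norm_num)
  have hQ2 : Q ≤ 24 * C * h ^ (1 / 32 : ℝ) * N ^ 4 := by
    calc Q ≤ _ := hQle
      _ = 16 * C * N ^ 4 * √ρ + 8 * C * N ^ 4 * (h / ρ ^ 8) := by ring
      _ ≤ 16 * C * N ^ 4 * h ^ (1 / 32 : ℝ) + 8 * C * N ^ 4 * h ^ (1 / 32 : ℝ) := by
        rw [e1]
        gcongr
      _ = _ := by ring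
  have e3 : (h ^ (1 / 128 : ℝ)) ^ 4 = h ^ (1 / 32 : ℝ) := by
    rw [← Real.rpow_natCast, ← Real.rpow_mul hh.le]
    norm_num
  have hn₀0 : 0 ≤ n₀ := ENNReal.toReal_nonneg
  have hn₁0 : 0 ≤ n₁ := ENNReal.toReal_nonneg
  refine le_of_pow_le_pow_left₀ (n := 4) (by norm_num) (by positivity) ?_
  -- Adding `1` makes the base at least `1`, which avoids taking a fourth root of the constant; `24
  -- = 2⁴ + 2³` comes from `‖f‖ ≤ 2N`.
  have hC4 : 24 * C ≤ (24 * C + 1) ^ 4 := by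
    have : 24 * C + 1 ≤ (24 * C + 1) ^ 4 := le_self_pow₀ (by linarith) (by norm_num)
    linarith
  calc _ ≤ (n₀ ^ 2) ^ 2 * (n₁ ^ 2) ^ 2 * Q := hcs
    _ ≤ (n₀ ^ 2) ^ 2 * (n₁ ^ 2) ^ 2 * (24 * C * h ^ (1 / 32 : ℝ) * N ^ 4) := by gcongr
    _ ≤ (n₀ ^ 2) ^ 2 * (n₁ ^ 2) ^ 2 * ((24 * C + 1) ^ 4 * h ^ (1 / 32 : ℝ) * N ^ 4) := by gcongr
    _ = _ := by
      rw [← e3]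
      ring

end Translation

/-! ### The trilinear form as a functional of its last argument. -/

section Functional

/-- Each slice in the second variable is a translation, so null sets pull back to null sets. This is
what makes the integrand meaningful for functions defined almost everywhere. -/
theorem quasiMeasurePreserving_add_comp {s : ℝ → ℝ} (hs : Measurable s) :
    Measure.QuasiMeasurePreserving (fun p : ℝ × ℝ => p.1 + s p.2) volume volume := by
  have hm : Measurable fun p : ℝ × ℝ => p.1 + s p.2 := by fun_prop
  refine ⟨hm, Measure.AbsolutelyContinuous.mk fun N hN h0 => ?_⟩
  rw [Measure.map_apply hm hN, Measure.volume_eq_prod, Measure.prod_apply_symm (hm hN),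
    lintegral_eq_zero_iff (measurable_measure_prodMk_right (hm hN))]
  refine Filter.Eventually.of_forall fun t => ?_
  exact (measure_preimage_add_right volume (s t) N).trans h0

theorem aestronglyMeasurable_trilinearIntegrand {χ : ℝ → ℝ} {f₀ f₁ f₂ : ℝ → ℂ}
    (hχ : Continuous χ) (h₀ : AEStronglyMeasurable f₀ volume)
    (h₁ : AEStronglyMeasurable f₁ volume) (h₂ : AEStronglyMeasurable f₂ volume) :
    AEStronglyMeasurable (fun p : ℝ × ℝ => trilinearIntegrand χ f₀ f₁ f₂ p.1 p.2) volume := by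
  have m0 : AEStronglyMeasurable (fun p : ℝ × ℝ => f₀ p.1) (volume.prod volume) := h₀.comp_fst
  have m1 := h₁.comp_quasiMeasurePreserving
    (quasiMeasurePreserving_add_comp (s := fun t => t) measurable_id)
  have m2 := h₂.comp_quasiMeasurePreserving
    (quasiMeasurePreserving_add_comp (s := fun t => t ^ 2) (by fun_prop))
  have m3 : AEStronglyMeasurable (fun p : ℝ × ℝ => (χ p.2 : ℂ)) volume :=
    (Complex.continuous_ofReal.comp (hχ.comp continuous_snd)).aestronglyMeasurable
  exact ((m0.mul m1).mul m2).mul m3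

/-- The bound of the trilinear form by Hölder's inequality for fixed `t`. -/
theorem lintegral_trilinearIntegrand_le {χ : ℝ → ℝ} {f₀ f₁ f₂ : ℝ → ℂ}
    (hχ : Continuous χ) (h₀ : AEStronglyMeasurable f₀ volume)
    (h₁ : AEStronglyMeasurable f₁ volume) (h₂ : AEStronglyMeasurable f₂ volume) :
    ∫⁻ p : ℝ × ℝ, ‖trilinearIntegrand χ f₀ f₁ f₂ p.1 p.2‖ₑ ≤
      (∫⁻ t, ‖χ t‖ₑ) * (eLpNorm f₀ ⊤ volume * eLpNorm f₁ 2 volume * eLpNorm f₂ 2 volume) := by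
  have hm := (aestronglyMeasurable_trilinearIntegrand hχ h₀ h₁ h₂).enorm
  rw [Measure.volume_eq_prod] at hm ⊢
  rw [lintegral_prod_symm _ hm, ← lintegral_mul_const _ hχ.enorm.measurable]
  refine lintegral_mono fun t => ?_
  have ht : ∀ x, ‖trilinearIntegrand χ f₀ f₁ f₂ x t‖ₑ =
      ‖χ t‖ₑ * (‖f₀ x‖ₑ * (‖f₁ (x + t)‖ₑ * ‖f₂ (x + t ^ 2)‖ₑ)) := fun x => by
    unfold trilinearIntegrand
    rw [enorm_mul, enorm_mul, enorm_mul, ← ofReal_norm (χ t : ℂ), Complex.norm_real, ofReal_norm]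
    ring
  simp only [ht]
  rw [lintegral_const_mul' _ _ enorm_ne_top]
  refine mul_le_mul' le_rfl ?_
  have hf0 : ∀ᵐ x, ‖f₀ x‖ₑ ≤ eLpNorm f₀ ⊤ volume := by
    rw [eLpNorm_exponent_top]
    exact ae_le_eLpNormEssSup
  have m1 : AEMeasurable (fun x => ‖f₁ (x + t)‖ₑ) volume :=
    h₁.enorm.comp_quasiMeasurePreserving
      (measurePreserving_add_right volume t).quasiMeasurePreserving
  have m2 : AEMeasurable (fun x => ‖f₂ (x + t ^ 2)‖ₑ) volume :=
    h₂.enorm.comp_quasiMeasurePreserving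
      (measurePreserving_add_right volume (t ^ 2)).quasiMeasurePreserving
  have hCS := ENNReal.lintegral_mul_le_Lp_mul_Lq volume Real.HolderConjugate.two_two m1 m2
  have e1 : ∫⁻ x, ‖f₁ (x + t)‖ₑ ^ (2 : ℝ) = ∫⁻ x, ‖f₁ x‖ₑ ^ (2 : ℝ) :=
    lintegral_add_right_eq_self (fun x => ‖f₁ x‖ₑ ^ (2 : ℝ)) t
  have e2 : ∫⁻ x, ‖f₂ (x + t ^ 2)‖ₑ ^ (2 : ℝ) = ∫⁻ x, ‖f₂ x‖ₑ ^ (2 : ℝ) :=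
    lintegral_add_right_eq_self (fun x => ‖f₂ x‖ₑ ^ (2 : ℝ)) (t ^ 2)
  rw [e1, e2] at hCS
  calc ∫⁻ x, ‖f₀ x‖ₑ * (‖f₁ (x + t)‖ₑ * ‖f₂ (x + t ^ 2)‖ₑ)
      ≤ ∫⁻ x, eLpNorm f₀ ⊤ volume * (‖f₁ (x + t)‖ₑ * ‖f₂ (x + t ^ 2)‖ₑ) := by
        refine lintegral_mono_ae ?_
        filter_upwards [hf0] with x hx
        gcongr
    _ = eLpNorm f₀ ⊤ volume * ∫⁻ x, ‖f₁ (x + t)‖ₑ * ‖f₂ (x + t ^ 2)‖ₑ :=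
        lintegral_const_mul'' _ (m1.mul m2)
    _ ≤ eLpNorm f₀ ⊤ volume * (eLpNorm f₁ 2 volume * eLpNorm f₂ 2 volume) := by
        gcongr
        rw [← l2norm_eq_eLpNorm, ← l2norm_eq_eLpNorm]
        simpa [l2norm] using hCS
    _ = _ := by ring

theorem integrable_trilinearIntegrand {χ : ℝ → ℝ} {f₀ f₁ f₂ : ℝ → ℂ}
    (hχ : Continuous χ) (hχs : HasCompactSupport χ) (h₀ : MemLp f₀ ⊤ volume)
    (h₁ : MemLp f₁ 2 volume) (h₂ : MemLp f₂ 2 volume) :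
    Integrable (fun p : ℝ × ℝ => trilinearIntegrand χ f₀ f₁ f₂ p.1 p.2) volume := by
  refine ⟨aestronglyMeasurable_trilinearIntegrand hχ h₀.1 h₁.1 h₂.1, ?_⟩
  refine (lintegral_trilinearIntegrand_le hχ h₀.1 h₁.1 h₂.1).trans_lt ?_
  have hi : ∫⁻ t, ‖χ t‖ₑ < ⊤ := (hχ.integrable_of_hasCompactSupport hχs).2
  exact ENNReal.mul_lt_top hi (ENNReal.mul_lt_top (ENNReal.mul_lt_top h₀.2 h₁.2) h₂.2)

theorem trilinearIntegrand_congr_ae {χ : ℝ → ℝ} {f₀ f₁ f₂ g : ℝ → ℂ} (h : f₂ =ᵐ[volume] g) :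
    (fun p : ℝ × ℝ => trilinearIntegrand χ f₀ f₁ f₂ p.1 p.2) =ᵐ[volume]
      fun p : ℝ × ℝ => trilinearIntegrand χ f₀ f₁ g p.1 p.2 := by
  have := (quasiMeasurePreserving_add_comp (s := fun t => t ^ 2) (by fun_prop)).ae_eq_comp h
  filter_upwards [this] with p hp
  have hp' : f₂ (p.1 + p.2 ^ 2) = g (p.1 + p.2 ^ 2) := hp
  simp only [trilinearIntegrand, hp']

/-- The trilinear form as a bounded linear functional of the last function. -/
theorem exists_trilinear_functional {χ : ℝ → ℝ} {f₀ f₁ : ℝ → ℂ}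
    (hχ : Continuous χ) (hχs : HasCompactSupport χ) (h₀ : MemLp f₀ ⊤ volume)
    (h₁ : MemLp f₁ 2 volume) :
    ∃ ℓ : Lp ℂ 2 (volume : Measure ℝ) →L[ℂ] ℂ,
      (∀ (f₂ : ℝ → ℂ) (h₂ : MemLp f₂ 2 volume), ℓ (h₂.toLp f₂) =
        ∫ p : ℝ × ℝ, trilinearIntegrand χ f₀ f₁ f₂ p.1 p.2) ∧
      ∀ φ, ‖ℓ φ‖ ≤ ((∫⁻ t, ‖χ t‖ₑ) * (eLpNorm f₀ ⊤ volume * eLpNorm f₁ 2 volume)).toReal * ‖φ‖ := by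
  have hint : ∀ φ : Lp ℂ 2 (volume : Measure ℝ), Integrable (fun p : ℝ × ℝ =>
      trilinearIntegrand χ f₀ f₁ φ p.1 p.2) volume := fun φ =>
    integrable_trilinearIntegrand hχ hχs h₀ h₁ (Lp.memLp φ)
  let L : Lp ℂ 2 (volume : Measure ℝ) →ₗ[ℂ] ℂ :=
    { toFun := fun φ => ∫ p : ℝ × ℝ, trilinearIntegrand χ f₀ f₁ φ p.1 p.2
      map_add' := fun φ ψ => by
        rw [← integral_add (hint φ) (hint ψ)]
        refine integral_congr_ae ((trilinearIntegrand_congr_ae (Lp.coeFn_add φ ψ)).trans ?_)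
        filter_upwards with p
        simp only [trilinearIntegrand, Pi.add_apply]
        ring
      map_smul' := fun c φ => by
        simp only [RingHom.id_apply, smul_eq_mul]
        rw [← integral_const_mul]
        refine integral_congr_ae ((trilinearIntegrand_congr_ae (Lp.coeFn_smul c φ)).trans ?_)
        filter_upwards with p
        simp only [trilinearIntegrand, Pi.smul_apply, smul_eq_mul]
        ring }
  have hi : ∫⁻ t, ‖χ t‖ₑ < ⊤ := (hχ.integrable_of_hasCompactSupport hχs).2
  have bound : ∀ φ, ‖L φ‖ ≤
      ((∫⁻ t, ‖χ t‖ₑ) * (eLpNorm f₀ ⊤ volume * eLpNorm f₁ 2 volume)).toReal * ‖φ‖ := by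
    intro φ
    have h1 : ‖L φ‖ₑ ≤ ((∫⁻ t, ‖χ t‖ₑ) * (eLpNorm f₀ ⊤ volume * eLpNorm f₁ 2 volume)) *
        eLpNorm φ 2 volume := by
      refine (enorm_integral_le_lintegral_enorm _).trans
        ((lintegral_trilinearIntegrand_le hχ h₀.1 h₁.1 (Lp.memLp φ).1).trans (le_of_eq ?_))
      ring
    have hfin : ((∫⁻ t, ‖χ t‖ₑ) * (eLpNorm f₀ ⊤ volume * eLpNorm f₁ 2 volume)) *
        eLpNorm φ 2 volume ≠ ⊤ :=
      (ENNReal.mul_lt_top (ENNReal.mul_lt_top hi (ENNReal.mul_lt_top h₀.2 h₁.2))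
        (Lp.memLp φ).2).ne
    have h2 := ENNReal.toReal_mono hfin h1
    rw [toReal_enorm, ENNReal.toReal_mul] at h2
    exact h2
  refine ⟨L.mkContinuous _ bound, fun f₂ h₂ => ?_, bound⟩
  exact integral_congr_ae (trilinearIntegrand_congr_ae h₂.coeFn_toLp)

theorem integral_trilinearIntegrand_eq {χ : ℝ → ℝ} {f₀ f₁ f : ℝ → ℂ}
    (hi : Integrable (fun p : ℝ × ℝ => trilinearIntegrand χ f₀ f₁ f p.1 p.2) volume) :
    ∫ p : ℝ × ℝ, trilinearIntegrand χ f₀ f₁ f p.1 p.2 =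
      ∫ x, f₀ x * ∫ y, f₁ y * parabolaKernel χ f x y := by
  rw [Measure.volume_eq_prod] at hi ⊢
  rw [integral_prod _ hi]
  refine integral_congr_ae (Filter.Eventually.of_forall fun x => ?_)
  simp only
  rw [← integral_const_mul]
  refine Eq.trans ?_
    (integral_add_left_eq_self (fun y => f₀ x * (f₁ y * parabolaKernel χ f x y)) x)
  refine integral_congr_ae (Filter.Eventually.of_forall fun t => ?_)
  simp only [trilinearIntegrand, parabolaKernel, add_sub_cancel_left]
  ring

/-- Translation on `L²`. -/
noncomputable def translateLp (h : ℝ) :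
    Lp ℂ 2 (volume : Measure ℝ) →ₗᵢ[ℂ] Lp ℂ 2 (volume : Measure ℝ) :=
  Lp.compMeasurePreservingₗᵢ ℂ (fun x => x + h) (measurePreserving_add_right volume h)

theorem translateLp_toLp (h : ℝ) {f : ℝ → ℂ} (hf : MemLp f 2 volume) :
    translateLp h (hf.toLp f) =
      (hf.comp_measurePreserving (measurePreserving_add_right volume h)).toLp _ := rfl

theorem translateLp_neg_cancel (h : ℝ) (φ : Lp ℂ 2 (volume : Measure ℝ)) :
    translateLp h (translateLp (-h) φ) = φ := by
  apply Lp.ext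
  have e1 : translateLp h (translateLp (-h) φ) =ᵐ[volume] fun x => translateLp (-h) φ (x + h) :=
    Lp.coeFn_compMeasurePreserving _ (measurePreserving_add_right volume h)
  have e2 : translateLp (-h) φ =ᵐ[volume] fun x => φ (x + -h) :=
    Lp.coeFn_compMeasurePreserving _ (measurePreserving_add_right volume (-h))
  have e3 := (measurePreserving_add_right volume h).quasiMeasurePreserving.ae_eq_comp e2
  filter_upwards [e1, e3] with x h1 h3
  have h3' : translateLp (-h) φ (x + h) = φ (x + h + -h) := h3
  rw [h1, h3', add_neg_cancel_right]

/-- The bounded support of `f₀` serves only to pass from `L^∞` to the `L²` norm required by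
Cauchy-Schwarz. -/
theorem eLpNorm_two_le_of_support {f₀ : ℝ → ℂ} {a b : ℝ} (h₀ : MemLp f₀ ⊤ volume)
    (hs : ∀ᵐ x : ℝ, x ∉ Set.Icc a b → f₀ x = 0) :
    eLpNorm f₀ 2 volume ≤ eLpNorm f₀ ⊤ volume * ENNReal.ofReal (b - a) ^ (1 / 2 : ℝ) := by
  have e : f₀ =ᵐ[volume] (Set.Icc a b).indicator f₀ := by
    filter_upwards [hs] with x hx
    by_cases h : x ∈ Set.Icc a b
    · simp [h]
    · simp [h, hx h]
  calc eLpNorm f₀ 2 volume = eLpNorm ((Set.Icc a b).indicator f₀) 2 volume := eLpNorm_congr_ae e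
    _ = eLpNorm f₀ 2 (volume.restrict (Set.Icc a b)) :=
        eLpNorm_indicator_eq_eLpNorm_restrict measurableSet_Icc
    _ ≤ eLpNorm f₀ ⊤ (volume.restrict (Set.Icc a b)) *
        (volume.restrict (Set.Icc a b)) Set.univ ^ (1 / (2 : ℝ≥0∞).toReal - 1 / (⊤ : ℝ≥0∞).toReal) :=
        eLpNorm_le_eLpNorm_mul_rpow_measure_univ le_top h₀.1.restrict
    _ ≤ _ := by
        have he : 1 / (2 : ℝ≥0∞).toReal - 1 / (⊤ : ℝ≥0∞).toReal = 1 / 2 := by simp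
        rw [Measure.restrict_apply_univ, Real.volume_Icc, he]
        refine mul_le_mul' ?_ le_rfl
        exact eLpNorm_mono_measure f₀ Measure.restrict_le_self

/-- The functional of the trilinear form is Hölder continuous under translations. -/
theorem exists_functional_translation_bound {χ : ℝ → ℝ} (hχ : ContDiff ℝ 1 χ)
    (hχs : HasCompactSupport χ) (hχ01 : ∀ t, 0 ≤ χ t ∧ χ t ≤ 1) (a b : ℝ) :
    ∃ C : ℝ, 0 ≤ C ∧ ∀ f₀ f₁ : ℝ → ℂ, MemLp f₀ ⊤ volume →
      (∀ᵐ x : ℝ, x ∉ Set.Icc a b → f₀ x = 0) → MemLp f₁ 2 volume →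
      ∀ ℓ : Lp ℂ 2 (volume : Measure ℝ) →L[ℂ] ℂ,
      (∀ (f₂ : ℝ → ℂ) (h₂ : MemLp f₂ 2 volume), ℓ (h₂.toLp f₂) =
        ∫ p : ℝ × ℝ, trilinearIntegrand χ f₀ f₁ f₂ p.1 p.2) →
      ∀ h : ℝ, 0 < h → h ≤ 1 → ∀ φ, ‖ℓ (translateLp h φ - φ)‖ ≤
        C * h ^ (1 / 128 : ℝ) * (eLpNorm f₀ ⊤ volume).toReal * (eLpNorm f₁ 2 volume).toReal *
          ‖φ‖ := by
  obtain ⟨C, hC0, hC⟩ := exists_translation_bound hχ hχs hχ01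
  set D := (ENNReal.ofReal (b - a) ^ (1 / 2 : ℝ)).toReal with hD
  have hD0 : 0 ≤ D := ENNReal.toReal_nonneg
  refine ⟨C * D, by positivity, ?_⟩
  intro f₀ f₁ h₀ hs h₁ ℓ hℓ h hh hh1 φ
  have hn : eLpNorm f₀ 2 volume ≤ eLpNorm f₀ ⊤ volume * ENNReal.ofReal (b - a) ^ (1 / 2 : ℝ) :=
    eLpNorm_two_le_of_support h₀ hs
  have hfin : ENNReal.ofReal (b - a) ^ (1 / 2 : ℝ) ≠ ⊤ :=
    ENNReal.rpow_ne_top_of_nonneg (by norm_num) ENNReal.ofReal_ne_top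
  have h₀' : MemLp f₀ 2 volume := ⟨h₀.1, hn.trans_lt (ENNReal.mul_lt_top h₀.2 hfin.lt_top)⟩
  have hn' : (eLpNorm f₀ 2 volume).toReal ≤ (eLpNorm f₀ ⊤ volume).toReal * D := by
    rw [hD, ← ENNReal.toReal_mul]
    exact ENNReal.toReal_mono (ENNReal.mul_ne_top h₀.2.ne hfin) hn
  -- Both sides are continuous in `φ`, so smooth compactly supported functions suffice; only for
  -- these has the box form been computed.
  refine (Lp.dense_hasCompactSupport_contDiff (F := ℂ) (E := ℝ) (μ := volume) (p := 2)
    (by norm_num)).induction (P := fun φ => ‖ℓ (translateLp h φ - φ)‖ ≤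
        C * D * h ^ (1 / 128 : ℝ) * (eLpNorm f₀ ⊤ volume).toReal * (eLpNorm f₁ 2 volume).toReal *
          ‖φ‖) ?_ ?_ φ
  · rintro φ ⟨F, hφF, hFs, hFd⟩
    have hF1 : ContDiff ℝ 1 F := hFd.of_le (by exact_mod_cast le_top)
    have hFL : MemLp F 2 volume := hF1.continuous.memLp_of_hasCompactSupport hFs
    have hφ : φ = hFL.toLp F := Lp.ext (hφF.trans hFL.coeFn_toLp.symm)
    have hdiff : MemLp (fun x => F (x + h) - F x) 2 volume :=
      (hFL.comp_measurePreserving (measurePreserving_add_right volume h)).sub hFL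
    have e1 : translateLp h φ - φ = hdiff.toLp _ := by
      rw [hφ, translateLp_toLp, ← MemLp.toLp_sub]
      rfl
    have hint := integrable_trilinearIntegrand hχ.continuous hχs h₀ h₁ hdiff
    rw [e1, hℓ _ hdiff, integral_trilinearIntegrand_eq hint]
    have hnφ : ‖φ‖ = (eLpNorm F 2 volume).toReal := by
      rw [hφ, Lp.norm_toLp]
    rw [hnφ]
    refine (hC f₀ f₁ F h₀' h₁ hF1 hFs h hh hh1).trans ?_
    calc _ ≤ C * h ^ (1 / 128 : ℝ) * ((eLpNorm f₀ ⊤ volume).toReal * D) *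
          (eLpNorm f₁ 2 volume).toReal * (eLpNorm F 2 volume).toReal := by gcongr
      _ = _ := by ring
  · have hc := (translateLp h).continuous
    exact isClosed_le (by fun_prop) (by fun_prop)

end Functional

/-! ### Translations and modulations on `L²`. -/

section FourierSide

open ComplexConjugate

/-- The character `ξ ↦ e^{2πihξ}` as an element of `L^∞`. -/
noncomputable def charLp (h : ℝ) : Lp ℂ ⊤ (volume : Measure ℝ) :=
  (memLp_top_of_bound (f := fun ξ : ℝ => (𝐞 (h * ξ) : ℂ))
    (by
      have : Continuous fun ξ : ℝ => (𝐞 (h * ξ) : ℂ) :=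
        continuous_subtype_val.comp (Real.continuous_fourierChar.comp (by fun_prop))
      exact this.aestronglyMeasurable) 1
    (Filter.Eventually.of_forall fun ξ => (Circle.norm_coe _).le)).toLp _

/-- Multiplication by the character `ξ ↦ e^{2πihξ}` on `L²`. -/
noncomputable def mulCharLp (h : ℝ) :
    Lp ℂ 2 (volume : Measure ℝ) →L[ℂ] Lp ℂ 2 (volume : Measure ℝ) :=
  (ContinuousLinearMap.mul ℂ ℂ).holderL volume ⊤ 2 2 (charLp h)

theorem coeFn_mulCharLp (h : ℝ) (φ : Lp ℂ 2 (volume : Measure ℝ)) :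
    mulCharLp h φ =ᵐ[volume] fun ξ => (𝐞 (h * ξ) : ℂ) * φ ξ := by
  have h1 : mulCharLp h φ =ᵐ[volume] fun ξ => charLp h ξ * φ ξ :=
    (ContinuousLinearMap.mul ℂ ℂ).coeFn_holder (r := 2) (charLp h) φ
  have h2 : charLp h =ᵐ[volume] fun ξ => (𝐞 (h * ξ) : ℂ) := MemLp.coeFn_toLp _
  filter_upwards [h1, h2] with ξ e1 e2
  rw [e1, e2]

/-- The `L²` Fourier transform turns translations into modulations. -/
theorem fourier_translateLp (h : ℝ) (φ : Lp ℂ 2 (volume : Measure ℝ)) :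
    𝓕 (translateLp h φ) = mulCharLp h (𝓕 φ) := by
  have hL : Continuous fun φ : Lp ℂ 2 (volume : Measure ℝ) => 𝓕 (translateLp h φ) :=
    (Lp.fourierTransformₗᵢ ℝ ℂ).continuous.comp (translateLp h).continuous
  have hR : Continuous fun φ : Lp ℂ 2 (volume : Measure ℝ) => mulCharLp h (𝓕 φ) :=
    (mulCharLp h).continuous.comp (Lp.fourierTransformₗᵢ ℝ ℂ).continuous
  -- Both sides are continuous on `L²`, so the identity is checked on Schwartz functions, where the
  -- transform is an integral.
  refine congrFun ((SchwartzMap.denseRange_toLpCLM (F := ℂ) (E := ℝ) (p := 2)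
    (μ := volume) (by norm_num)).equalizer hL hR (funext fun f => ?_)) φ
  simp only [Function.comp_apply, SchwartzMap.toLpCLM_apply]
  have e1 : translateLp h (f.toLp 2) = (f.compSubConstCLM ℂ (-h)).toLp 2 := by
    apply Lp.ext
    refine (Lp.coeFn_compMeasurePreserving _ (measurePreserving_add_right volume h)).trans ?_
    have e2 := (measurePreserving_add_right volume h).quasiMeasurePreserving.ae_eq_comp
      (f.coeFn_toLp 2)
    refine e2.trans ?_
    filter_upwards [(f.compSubConstCLM ℂ (-h)).coeFn_toLp 2] with x hx
    rw [hx, SchwartzMap.compSubConstCLM_apply, sub_neg_eq_add]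
    rfl
  rw [e1, SchwartzMap.toLp_fourier_eq, SchwartzMap.toLp_fourier_eq]
  apply Lp.ext
  filter_upwards [(𝓕 (f.compSubConstCLM ℂ (-h))).coeFn_toLp 2,
    coeFn_mulCharLp h ((𝓕 f).toLp 2), (𝓕 f).coeFn_toLp 2] with ξ h1 h2 h3
  rw [h1, h2, h3, SchwartzMap.fourier_coe, SchwartzMap.fourier_coe]
  have e3 : (f.compSubConstCLM ℂ (-h) : ℝ → ℂ) = (f : ℝ → ℂ) ∘ fun x => x + h := by
    ext x
    rw [SchwartzMap.compSubConstCLM_apply, sub_neg_eq_add]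
    rfl
  rw [e3]
  have := congrFun (VectorFourier.fourierIntegral_comp_add_right 𝐞 volume (innerₗ ℝ) (f : ℝ → ℂ) h) ξ
  refine this.trans ?_
  rw [Circle.smul_def, smul_eq_mul]
  congr 3
  simp [mul_comm]

/-- The modulus `|e^{2πihξ} - 1|`. -/
theorem one_le_norm_fourierChar_sub_one {h ξ : ℝ} (h1 : 1 / 4 ≤ |h * ξ|) (h2 : |h * ξ| ≤ 1 / 2) :
    1 ≤ ‖(𝐞 (h * ξ) : ℂ) - 1‖ := by
  have e : (𝐞 (h * ξ) : ℂ) = Complex.exp (Complex.I * ((2 * Real.pi * (h * ξ) : ℝ) : ℂ)) := by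
    rw [Real.fourierChar_apply, mul_comm]
  rw [e, Complex.norm_exp_I_mul_ofReal_sub_one, norm_mul, Real.norm_eq_abs, Real.norm_eq_abs]
  have h3 : 2 * Real.pi * (h * ξ) / 2 = Real.pi * (h * ξ) := by ring
  have hpi := Real.pi_pos
  have h4 : |Real.sin (Real.pi * (h * ξ))| = Real.sin (Real.pi * |h * ξ|) := by
    rcases abs_cases (h * ξ) with ⟨hx, -⟩ | ⟨hx, -⟩
    · have h6 : Real.sin (Real.pi * (h * ξ)) = Real.sin (Real.pi * |h * ξ|) := by rw [hx]
      rw [h6, abs_of_nonneg]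
      exact Real.sin_nonneg_of_nonneg_of_le_pi (by positivity) (by nlinarith)
    · have h5 : h * ξ = -|h * ξ| := by linarith
      have h6 : Real.sin (Real.pi * (h * ξ)) = -Real.sin (Real.pi * |h * ξ|) := by
        rw [← Real.sin_neg, ← mul_neg, ← h5]
      rw [h6, abs_neg, abs_of_nonneg]
      exact Real.sin_nonneg_of_nonneg_of_le_pi (by positivity) (by nlinarith)
  rw [h3, h4]
  have h7 := Real.mul_le_sin (x := Real.pi * |h * ξ|) (by positivity) (by nlinarith)
  have h8 : 2 / Real.pi * (Real.pi * |h * ξ|) = 2 * |h * ξ| := by field_simp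
  rw [h8] at h7
  have h9 : |(2 : ℝ)| = 2 := by norm_num
  rw [h9]
  linarith

/-- If `ℓ = ⟪G, ·⟫` is small on differences by `h` then `G` is close to its translate by `-h`. -/
theorem norm_translateLp_neg_sub_le {G : Lp ℂ 2 (volume : Measure ℝ)} {h D : ℝ} (hD : 0 ≤ D)
    (hG : ∀ φ, ‖inner ℂ G (translateLp h φ - φ)‖ ≤ D * ‖φ‖) :
    ‖translateLp (-h) G - G‖ ≤ D := by
  -- The adjoint of translation by `h` is translation by `-h`, so testing the hypothesis on `ψ`
  -- itself yields `‖ψ‖² ≤ D ‖ψ‖`.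
  set ψ := translateLp (-h) G - G with hψ
  have e1 : inner ℂ (translateLp (-h) G) ψ = inner ℂ G (translateLp h ψ) := by
    rw [← (translateLp h).inner_map_map (translateLp (-h) G) ψ, translateLp_neg_cancel]
  have e2 : inner ℂ ψ ψ = inner ℂ G (translateLp h ψ - ψ) := by
    rw [inner_sub_right G, ← e1, ← inner_sub_left]
  have h1 := hG ψ
  rw [← e2, inner_self_eq_norm_sq_to_K, norm_pow, RCLike.norm_ofReal, abs_norm] at h1
  by_cases h0 : ‖ψ‖ = 0
  · rw [h0]; exact hD
  · have hpos : 0 < ‖ψ‖ := lt_of_le_of_ne (norm_nonneg _) (Ne.symm h0)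
    nlinarith

theorem lintegral_fourierChar_sub_one_le {G : Lp ℂ 2 (volume : Measure ℝ)} {h D : ℝ}
    (hD : 0 ≤ D) (hG : ‖translateLp h G - G‖ ≤ D) :
    ∫⁻ ξ, ‖(𝐞 (h * ξ) : ℂ) - 1‖ₑ ^ 2 * ‖(𝓕 G : Lp ℂ 2 (volume : Measure ℝ)) ξ‖ₑ ^ 2 ≤
      ENNReal.ofReal (D ^ 2) := by
  set Γ : Lp ℂ 2 (volume : Measure ℝ) := 𝓕 G with hΓ
  have e1 : (Lp.fourierTransformₗᵢ ℝ ℂ) (translateLp h G - G) = mulCharLp h Γ - Γ := by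
    rw [map_sub]
    exact congrArg (· - Γ) (fourier_translateLp h G)
  have e2 : ‖mulCharLp h Γ - Γ‖ ≤ D := by
    rw [← e1, LinearIsometryEquiv.norm_map]
    exact hG
  have e3 : eLpNorm (mulCharLp h Γ - Γ : Lp ℂ 2 (volume : Measure ℝ)) 2 volume ≤
      ENNReal.ofReal D := by
    rw [← Lp.enorm_def, ← ofReal_norm]
    exact ENNReal.ofReal_le_ofReal e2
  have e4 : eLpNorm (mulCharLp h Γ - Γ : Lp ℂ 2 (volume : Measure ℝ)) 2 volume =
      eLpNorm (fun ξ => ((𝐞 (h * ξ) : ℂ) - 1) * Γ ξ) 2 volume := by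
    refine eLpNorm_congr_ae ?_
    filter_upwards [Lp.coeFn_sub (mulCharLp h Γ) Γ, coeFn_mulCharLp h Γ] with ξ h1 h2
    rw [h1, Pi.sub_apply, h2]
    ring
  rw [e4, ← l2norm_eq_eLpNorm] at e3
  have hsq : ∀ y : ℝ≥0∞, (y ^ (1 / 2 : ℝ)) ^ 2 = y := fun y => by
    rw [← ENNReal.rpow_natCast, ← ENNReal.rpow_mul]; norm_num
  have e5 : l2norm (fun ξ => ((𝐞 (h * ξ) : ℂ) - 1) * Γ ξ) ^ 2 ≤ ENNReal.ofReal D ^ 2 := by gcongr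
  unfold l2norm at e5
  rw [hsq, ← ENNReal.ofReal_pow hD] at e5
  refine le_trans (le_of_eq ?_) e5
  refine lintegral_congr fun ξ => ?_
  rw [enorm_mul, mul_pow]

end FourierSide

/-! ### From translation regularity to a Sobolev bound. -/

section SobolevDuality

/-- Plancherel, then Cauchy-Schwarz after inserting `1 = (1 + ξ²)^(σ/2) (1 + ξ²)^(-σ/2)`. -/
theorem enorm_inner_le_sobolev (σ : ℝ) (G φ : Lp ℂ 2 (volume : Measure ℝ)) :
    ‖inner ℂ G φ‖ₑ ≤ (∫⁻ ξ, ENNReal.ofReal ((1 + ξ ^ 2) ^ σ) *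
      ‖(𝓕 G : Lp ℂ 2 (volume : Measure ℝ)) ξ‖ₑ ^ 2) ^ (1 / 2 : ℝ) * sobolevNorm (-σ) φ := by
  rw [← Lp.inner_fourier_eq, L2.inner_def]
  set Γ : Lp ℂ 2 (volume : Measure ℝ) := 𝓕 G with hΓ
  set Φ : Lp ℂ 2 (volume : Measure ℝ) := 𝓕 φ with hΦ
  have hw : ∀ ξ : ℝ, 0 < 1 + ξ ^ 2 := fun ξ => by positivity
  have hcont : ∀ s : ℝ, Continuous fun ξ : ℝ => (1 + ξ ^ 2) ^ s := fun s =>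
    Continuous.rpow_const (by fun_prop) fun ξ => Or.inl (hw ξ).ne'
  let f : ℝ → ℝ≥0∞ := fun ξ => ENNReal.ofReal ((1 + ξ ^ 2) ^ (σ / 2)) * ‖Γ ξ‖ₑ
  let g : ℝ → ℝ≥0∞ := fun ξ => ENNReal.ofReal ((1 + ξ ^ 2) ^ (-σ / 2)) * ‖Φ ξ‖ₑ
  have hf : AEMeasurable f volume :=
    (hcont _).measurable.ennreal_ofReal.aemeasurable.mul (Lp.aestronglyMeasurable Γ).enorm
  have hg : AEMeasurable g volume :=
    (hcont _).measurable.ennreal_ofReal.aemeasurable.mul (Lp.aestronglyMeasurable Φ).enorm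
  have hsq : ∀ s ξ : ℝ, ENNReal.ofReal ((1 + ξ ^ 2) ^ (s / 2)) ^ 2 =
      ENNReal.ofReal ((1 + ξ ^ 2) ^ s) := fun s ξ => by
    rw [← ENNReal.ofReal_pow (Real.rpow_nonneg (hw ξ).le _), ← Real.rpow_natCast,
      ← Real.rpow_mul (hw ξ).le]
    congr 2
    push_cast
    ring
  have e1 : ∫⁻ ξ, f ξ ^ (2 : ℝ) = ∫⁻ ξ, ENNReal.ofReal ((1 + ξ ^ 2) ^ σ) * ‖Γ ξ‖ₑ ^ 2 := by
    refine lintegral_congr fun ξ => ?_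
    rw [ENNReal.rpow_two, mul_pow, hsq]
  have e2 : (∫⁻ ξ, g ξ ^ (2 : ℝ)) ^ (1 / 2 : ℝ) = sobolevNorm (-σ) φ := by
    unfold sobolevNorm
    congr 1
    refine lintegral_congr fun ξ => ?_
    rw [ENNReal.rpow_two, mul_pow, hsq, sq_abs, ENNReal.ofReal_mul (by positivity),
      ENNReal.ofReal_pow (norm_nonneg _), ofReal_norm, mul_comm]
  calc ‖∫ ξ, inner ℂ (Γ ξ) (Φ ξ)‖ₑ ≤ ∫⁻ ξ, ‖inner ℂ (Γ ξ) (Φ ξ)‖ₑ :=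
        enorm_integral_le_lintegral_enorm _
    _ ≤ ∫⁻ ξ, (f * g) ξ := by
        refine lintegral_mono fun ξ => ?_
        have hone : ENNReal.ofReal ((1 + ξ ^ 2) ^ (σ / 2)) *
            ENNReal.ofReal ((1 + ξ ^ 2) ^ (-σ / 2)) = 1 := by
          rw [← ENNReal.ofReal_mul (Real.rpow_nonneg (hw ξ).le _), ← Real.rpow_add (hw ξ)]
          have : σ / 2 + -σ / 2 = 0 := by ring
          rw [this, Real.rpow_zero, ENNReal.ofReal_one]
        calc ‖inner ℂ (Γ ξ) (Φ ξ)‖ₑ ≤ ‖Γ ξ‖ₑ * ‖Φ ξ‖ₑ := by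
              rw [← ofReal_norm, ← ofReal_norm, ← ofReal_norm,
                ← ENNReal.ofReal_mul (norm_nonneg _)]
              exact ENNReal.ofReal_le_ofReal (norm_inner_le_norm _ _)
          _ = (ENNReal.ofReal ((1 + ξ ^ 2) ^ (σ / 2)) *
                ENNReal.ofReal ((1 + ξ ^ 2) ^ (-σ / 2))) * (‖Γ ξ‖ₑ * ‖Φ ξ‖ₑ) := by
              rw [hone, one_mul]
          _ = (f * g) ξ := by
              simp only [f, g, Pi.mul_apply]
              ring
    _ ≤ (∫⁻ ξ, f ξ ^ (2 : ℝ)) ^ (1 / 2 : ℝ) * (∫⁻ ξ, g ξ ^ (2 : ℝ)) ^ (1 / 2 : ℝ) :=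
        ENNReal.lintegral_mul_le_Lp_mul_Lq volume Real.HolderConjugate.two_two hf hg
    _ = _ := by rw [e1, e2]

/-- The Sobolev weight is dominated by a square function of dyadic differences. -/
theorem sobolev_weight_le (η : ℝ) :
    ENNReal.ofReal ((1 + η ^ 2) ^ (1 / 256 : ℝ)) ≤
      2 + ∑' j : ℕ, ENNReal.ofReal ((2 : ℝ) ^ ((j : ℝ) / 128)) *
        ‖(𝐞 (-(1 / 2) ^ j * η) : ℂ) - 1‖ₑ ^ 2 := by
  have hpos : 0 < 1 + η ^ 2 := by positivity
  rcases le_or_gt |η| 1 with h | h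
  · refine le_trans ?_ le_self_add
    have h1 : 1 + η ^ 2 ≤ 2 := by
      have : η ^ 2 ≤ 1 := (sq_le_one_iff_abs_le_one η).2 h
      linarith
    have h2 : (1 + η ^ 2) ^ (1 / 256 : ℝ) ≤ 2 := by
      calc (1 + η ^ 2) ^ (1 / 256 : ℝ) ≤ (1 + η ^ 2) ^ (1 : ℝ) :=
            Real.rpow_le_rpow_of_exponent_le (by nlinarith [sq_nonneg η]) (by norm_num)
        _ ≤ 2 := by rw [Real.rpow_one]; exact h1
    calc _ ≤ ENNReal.ofReal 2 := ENNReal.ofReal_le_ofReal h2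
      _ = 2 := by simp
  -- With `2^n ≤ |η| < 2^(n+1)`, the single term `j = n + 2` suffices: `2^(-j) |η|` lies in `[1/4,
  -- 1/2]`, where the character differs from `1` by at least `1`. The additive `2` serves `|η| ≤ 1`.
  · obtain ⟨n, hn1, hn2⟩ := exists_nat_pow_near h.le (by norm_num : (1 : ℝ) < 2)
    refine le_trans ?_ (le_trans (ENNReal.le_tsum (n + 2)) le_add_self)
    have hprod : |-(1 / 2) ^ (n + 2) * η| = |η| / 2 ^ (n + 2) := by
      rw [abs_mul, abs_neg, abs_of_pos (by positivity : (0 : ℝ) < (1 / 2) ^ (n + 2))]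
      rw [one_div, inv_pow]
      ring
    have h2n : (0 : ℝ) < 2 ^ n := by positivity
    have l1 : 1 / 4 ≤ |-(1 / 2) ^ (n + 2) * η| := by
      rw [hprod, le_div_iff₀ (by positivity), pow_add]
      linarith
    have l2 : |-(1 / 2) ^ (n + 2) * η| ≤ 1 / 2 := by
      rw [hprod, div_le_iff₀ (by positivity), pow_add]
      rw [pow_succ] at hn2
      linarith
    have h3 := one_le_norm_fourierChar_sub_one l1 l2
    have h4 : 1 ≤ ‖(𝐞 (-(1 / 2) ^ (n + 2) * η) : ℂ) - 1‖ₑ ^ 2 := by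
      refine one_le_pow₀ ?_
      rw [← ofReal_norm]
      exact ENNReal.one_le_ofReal.2 h3
    have h5 : (1 + η ^ 2) ^ (1 / 256 : ℝ) ≤ (2 : ℝ) ^ (((n + 2 : ℕ) : ℝ) / 128) := by
      have h6 : 1 + η ^ 2 ≤ (2 : ℝ) ^ (2 * ((n + 2 : ℕ) : ℝ)) := by
        have h7 : (2 : ℝ) ^ (2 * ((n + 2 : ℕ) : ℝ)) = (2 ^ (n + 2)) ^ 2 := by
          rw [mul_comm, Real.rpow_mul (by norm_num), Real.rpow_natCast]
          norm_num
        have h8 : η ^ 2 ≤ (2 ^ (n + 1)) ^ 2 := by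
          rw [← sq_abs]
          gcongr
        have h9 : (2 : ℝ) ^ (n + 2) = 2 * 2 ^ (n + 1) := by ring
        have h10 : (1 : ℝ) ≤ 2 ^ (n + 1) := one_le_pow₀ (by norm_num)
        rw [h7, h9]
        nlinarith
      calc (1 + η ^ 2) ^ (1 / 256 : ℝ) ≤ ((2 : ℝ) ^ (2 * ((n + 2 : ℕ) : ℝ))) ^ (1 / 256 : ℝ) :=
            Real.rpow_le_rpow hpos.le h6 (by norm_num)
        _ = _ := by
            rw [← Real.rpow_mul (by norm_num)]
            congr 1
            ring
    calc _ ≤ ENNReal.ofReal ((2 : ℝ) ^ (((n + 2 : ℕ) : ℝ) / 128)) * 1 := by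
          rw [mul_one]
          exact ENNReal.ofReal_le_ofReal h5
      _ ≤ _ := mul_le_mul' le_rfl h4

/-- At `h = 2^(-j)` the difference bound squared is `D² 2^(-2j/128)`. Against the weight `2^(j/128)`
this leaves the geometric term `D² 2^(-j/128)`: half of the available decay is spent on the Sobolev
weight and half on summability. -/
theorem lintegral_sobolev_weight_le {G : Lp ℂ 2 (volume : Measure ℝ)} {M D : ℝ} (hM0 : 0 ≤ M)
    (hD0 : 0 ≤ D) (hM : ‖G‖ ≤ M)
    (hD : ∀ h : ℝ, 0 < h → h ≤ 1 → ‖translateLp (-h) G - G‖ ≤ D * h ^ (1 / 128 : ℝ)) :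
    ∫⁻ ξ, ENNReal.ofReal ((1 + ξ ^ 2) ^ (1 / 256 : ℝ)) *
      ‖(𝓕 G : Lp ℂ 2 (volume : Measure ℝ)) ξ‖ₑ ^ 2 ≤
      ENNReal.ofReal (2 * M ^ 2 + D ^ 2 * (1 - (2 : ℝ) ^ (-(1 / 128) : ℝ))⁻¹) := by
  set Γ : Lp ℂ 2 (volume : Measure ℝ) := 𝓕 G with hΓ
  set r : ℝ := (2 : ℝ) ^ (-(1 / 128) : ℝ) with hr
  have hr0 : 0 ≤ r := by positivity
  have hr1 : r < 1 := Real.rpow_lt_one_of_one_lt_of_neg (by norm_num) (by norm_num)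
  have hΓm : AEMeasurable (fun ξ => ‖Γ ξ‖ₑ ^ 2) volume :=
    (Lp.aestronglyMeasurable Γ).enorm.pow_const 2
  have hem : ∀ j : ℕ, Measurable fun ξ : ℝ => ‖(𝐞 (-(1 / 2) ^ j * ξ) : ℂ) - 1‖ₑ ^ 2 := by
    intro j
    have : Continuous fun ξ : ℝ => (𝐞 (-(1 / 2) ^ j * ξ) : ℂ) - 1 :=
      (continuous_subtype_val.comp (Real.continuous_fourierChar.comp (by fun_prop))).sub
        continuous_const
    exact this.enorm.measurable.pow_const 2
  have first : ∫⁻ ξ, ‖Γ ξ‖ₑ ^ 2 ≤ ENNReal.ofReal (M ^ 2) := by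
    have h1 : eLpNorm Γ 2 volume ≤ ENNReal.ofReal M := by
      rw [← Lp.enorm_def, ← ofReal_norm, hΓ, Lp.norm_fourier_eq]
      exact ENNReal.ofReal_le_ofReal hM
    have hsq : ∀ y : ℝ≥0∞, (y ^ (1 / 2 : ℝ)) ^ 2 = y := fun y => by
      rw [← ENNReal.rpow_natCast, ← ENNReal.rpow_mul]; norm_num
    rw [← l2norm_eq_eLpNorm] at h1
    have h2 : l2norm Γ ^ 2 ≤ ENNReal.ofReal M ^ 2 := by gcongr
    unfold l2norm at h2
    rwa [hsq, ← ENNReal.ofReal_pow hM0] at h2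
  have term : ∀ j : ℕ, ∫⁻ ξ, ENNReal.ofReal ((2 : ℝ) ^ ((j : ℝ) / 128)) *
      ‖(𝐞 (-(1 / 2) ^ j * ξ) : ℂ) - 1‖ₑ ^ 2 * ‖Γ ξ‖ₑ ^ 2 ≤ ENNReal.ofReal (D ^ 2 * r ^ j) := by
    intro j
    have hh0 : (0 : ℝ) < (1 / 2) ^ j := by positivity
    have hh1 : ((1 : ℝ) / 2) ^ j ≤ 1 := pow_le_one₀ (by norm_num) (by norm_num)
    have h1 := lintegral_fourierChar_sub_one_le (by positivity) (hD _ hh0 hh1)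
    have hrj : ((1 : ℝ) / 2) ^ j = (2 : ℝ) ^ (-(j : ℝ)) := by
      rw [Real.rpow_neg (by norm_num), Real.rpow_natCast, one_div, inv_pow]
    calc _ = ENNReal.ofReal ((2 : ℝ) ^ ((j : ℝ) / 128)) *
          ∫⁻ ξ, ‖(𝐞 (-(1 / 2) ^ j * ξ) : ℂ) - 1‖ₑ ^ 2 * ‖Γ ξ‖ₑ ^ 2 := by
          rw [← lintegral_const_mul' _ _ ENNReal.ofReal_ne_top]
          refine lintegral_congr fun ξ => ?_
          ring
      _ ≤ ENNReal.ofReal ((2 : ℝ) ^ ((j : ℝ) / 128)) *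
          ENNReal.ofReal ((D * ((1 / 2) ^ j) ^ (1 / 128 : ℝ)) ^ 2) := by gcongr
      _ = ENNReal.ofReal (D ^ 2 * r ^ j) := by
          rw [← ENNReal.ofReal_mul (by positivity)]
          congr 1
          have p1 : ((2 : ℝ) ^ (-(j : ℝ) * (1 / 128))) ^ 2 = (2 : ℝ) ^ (-(j : ℝ) * (1 / 128) * 2) := by
            rw [Real.rpow_mul (by norm_num) _ 2, Real.rpow_two]
          have p2 : r ^ j = (2 : ℝ) ^ (-(1 / 128) * (j : ℝ)) := by
            rw [hr, Real.rpow_mul (by norm_num) _ (j : ℝ), Real.rpow_natCast]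
          rw [mul_pow, hrj, ← Real.rpow_mul (by norm_num), p1, p2, mul_left_comm,
            ← Real.rpow_add (by norm_num)]
          congr 2
          ring
  have hsum : Summable fun j : ℕ => D ^ 2 * r ^ j :=
    (summable_geometric_of_lt_one hr0 hr1).mul_left _
  have htm : ∀ j : ℕ, AEMeasurable (fun ξ => ENNReal.ofReal ((2 : ℝ) ^ ((j : ℝ) / 128)) *
      ‖(𝐞 (-(1 / 2) ^ j * ξ) : ℂ) - 1‖ₑ ^ 2 * ‖Γ ξ‖ₑ ^ 2) volume := fun j =>
    ((hem j).const_mul _).aemeasurable.mul hΓm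
  calc _ ≤ ∫⁻ ξ, (2 * ‖Γ ξ‖ₑ ^ 2 + ∑' j : ℕ, ENNReal.ofReal ((2 : ℝ) ^ ((j : ℝ) / 128)) *
        ‖(𝐞 (-(1 / 2) ^ j * ξ) : ℂ) - 1‖ₑ ^ 2 * ‖Γ ξ‖ₑ ^ 2) := by
        refine lintegral_mono fun ξ => ?_
        simp only
        rw [ENNReal.tsum_mul_right, ← add_mul]
        exact mul_le_mul' (sobolev_weight_le ξ) le_rfl
    _ = 2 * (∫⁻ ξ, ‖Γ ξ‖ₑ ^ 2) + ∑' j : ℕ, ∫⁻ ξ, ENNReal.ofReal ((2 : ℝ) ^ ((j : ℝ) / 128)) *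
        ‖(𝐞 (-(1 / 2) ^ j * ξ) : ℂ) - 1‖ₑ ^ 2 * ‖Γ ξ‖ₑ ^ 2 := by
        rw [lintegral_add_left' (hΓm.const_mul _), lintegral_const_mul'' _ hΓm,
          lintegral_tsum htm]
    _ ≤ 2 * ENNReal.ofReal (M ^ 2) + ∑' j : ℕ, ENNReal.ofReal (D ^ 2 * r ^ j) :=
        add_le_add (mul_le_mul' le_rfl first) (ENNReal.tsum_le_tsum term)
    _ = _ := by
        rw [← ENNReal.ofReal_tsum_of_nonneg (fun j => by positivity) hsum, tsum_mul_left,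
          tsum_geometric_of_lt_one hr0 hr1]
        have h1r : 0 ≤ (1 - r)⁻¹ := inv_nonneg.2 (by linarith)
        rw [ENNReal.ofReal_add (by positivity) (by positivity),
          ENNReal.ofReal_mul (p := 2) (by norm_num), ENNReal.ofReal_ofNat]

end SobolevDuality

/-! ### The main theorem. -/

theorem theorem1 :
    ∃ σ : ℝ, 0 < σ ∧
      ∀ (a b : ℝ) (χ : ℝ → ℝ), ContDiff ℝ ((⊤ : ℕ∞) : WithTop ℕ∞) χ → HasCompactSupport χ →
        (∀ t, 0 ≤ χ t ∧ χ t ≤ 1) →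
        ∃ C : ℝ≥0, ∀ (f₀ f₁ f₂ : ℝ → ℂ),
          MemLp f₀ ⊤ volume → (∀ᵐ x : ℝ, x ∉ Set.Icc a b → f₀ x = 0) →
          MemLp f₁ 2 volume → ∀ hf₂ : MemLp f₂ 2 volume,
          Integrable (fun p : ℝ × ℝ => trilinearIntegrand χ f₀ f₁ f₂ p.1 p.2) volume ∧
          ENNReal.ofReal (trilinearForm χ f₀ f₁ f₂) ≤
            C * eLpNorm f₀ ⊤ volume * eLpNorm f₁ 2 volume *
              sobolevNorm (-σ) (hf₂.toLp f₂) := by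
  -- The weight `(1 + ξ²)^σ` has size `|ξ|^(2σ)` at high frequency, and `2σ = 1/128` is half of the
  -- exponent `2/128` of the squared translation bound.
  refine ⟨1 / 256, by norm_num, fun a b χ hχ hχs hχ01 => ?_⟩
  have hχ1 : ContDiff ℝ 1 χ := hχ.of_le (by exact_mod_cast le_top)
  obtain ⟨C, hC0, hC⟩ := exists_functional_translation_bound hχ1 hχs hχ01 a b
  set M := (∫⁻ t, ‖χ t‖ₑ).toReal with hM
  have hM0 : 0 ≤ M := ENNReal.toReal_nonneg
  set S := (1 - (2 : ℝ) ^ (-(1 / 128) : ℝ))⁻¹ with hS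
  have hS0 : 0 ≤ S := by
    have : (2 : ℝ) ^ (-(1 / 128) : ℝ) < 1 :=
      Real.rpow_lt_one_of_one_lt_of_neg (by norm_num) (by norm_num)
    exact inv_nonneg.2 (by linarith)
  -- `M` comes from the Hölder bound, `C` from the translation bound and `S` from the geometric
  -- series. Both bounds are proportional to `n₀ n₁`, which factors out of the square root.
  refine ⟨(√(2 * M ^ 2 + C ^ 2 * S)).toNNReal, fun f₀ f₁ f₂ h₀ hs h₁ h₂ => ?_⟩
  have hint := integrable_trilinearIntegrand hχ1.continuous hχs h₀ h₁ h₂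
  refine ⟨hint, ?_⟩
  obtain ⟨ℓ, hℓ, hℓb⟩ := exists_trilinear_functional hχ1.continuous hχs h₀ h₁
  -- The Riesz representative, whose `H^σ` norm is the constant to be bounded.
  set G := (InnerProductSpace.toDual ℂ (Lp ℂ 2 (volume : Measure ℝ))).symm ℓ with hG
  have hGℓ : ∀ φ, inner ℂ G φ = ℓ φ := fun φ => InnerProductSpace.toDual_symm_apply
  set n₀ := (eLpNorm f₀ ⊤ volume).toReal with hn₀
  set n₁ := (eLpNorm f₁ 2 volume).toReal with hn₁
  have hn₀0 : 0 ≤ n₀ := ENNReal.toReal_nonneg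
  have hn₁0 : 0 ≤ n₁ := ENNReal.toReal_nonneg
  have hGM : ‖G‖ ≤ M * (n₀ * n₁) := by
    rw [hG, LinearIsometryEquiv.norm_map]
    refine ℓ.opNorm_le_bound (by positivity) fun φ => (hℓb φ).trans (le_of_eq ?_)
    rw [ENNReal.toReal_mul, ENNReal.toReal_mul]
  have hGD : ∀ h : ℝ, 0 < h → h ≤ 1 →
      ‖translateLp (-h) G - G‖ ≤ C * (n₀ * n₁) * h ^ (1 / 128 : ℝ) := by
    intro h hh hh1
    refine norm_translateLp_neg_sub_le (by positivity) fun φ => ?_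
    rw [hGℓ]
    refine (hC f₀ f₁ h₀ hs h₁ ℓ hℓ h hh hh1 φ).trans (le_of_eq ?_)
    ring
  have hw := lintegral_sobolev_weight_le (by positivity) (by positivity) hGM hGD
  rw [← hS] at hw
  have hform : ENNReal.ofReal (trilinearForm χ f₀ f₁ f₂) = ‖inner ℂ G (h₂.toLp f₂)‖ₑ := by
    rw [hGℓ, hℓ f₂ h₂, ← ofReal_norm]
    unfold trilinearForm
    rw [Measure.volume_eq_prod] at hint ⊢
    rw [integral_prod _ hint]
  rw [hform]
  refine (enorm_inner_le_sobolev (1 / 256) G (h₂.toLp f₂)).trans ?_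
  refine mul_le_mul' ?_ le_rfl
  have hK : (2 * (M * (n₀ * n₁)) ^ 2 + (C * (n₀ * n₁)) ^ 2 * S) =
      (√(2 * M ^ 2 + C ^ 2 * S) * (n₀ * n₁)) ^ 2 := by
    rw [mul_pow (√_), Real.sq_sqrt (by positivity)]
    ring
  calc _ ≤ ENNReal.ofReal ((√(2 * M ^ 2 + C ^ 2 * S) * (n₀ * n₁)) ^ 2) ^ (1 / 2 : ℝ) := by
        rw [← hK]
        gcongr
    _ = ENNReal.ofReal (√(2 * M ^ 2 + C ^ 2 * S) * (n₀ * n₁)) := by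
        rw [ENNReal.ofReal_pow (by positivity), ← ENNReal.rpow_natCast, ← ENNReal.rpow_mul]
        norm_num
    _ = _ := by
        rw [ENNReal.ofReal_mul (by positivity), ENNReal.ofReal_mul hn₀0, hn₀, hn₁,
          ENNReal.ofReal_toReal h₀.2.ne, ENNReal.ofReal_toReal h₁.2.ne, mul_assoc]
        rfl
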